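/- Let $G$ be a finite group and let $\mathcal{C}$ be a conjugacy class of $G$. If every $7$ members $c_1,\dots,c_7$ of $\mathcal{C}$ (not necessarily distinct) generate a solvable subgroup $\langle c_1,\dots,c_7\rangle$ of $G$, then the subgroup $\langle\mathcal{C}\rangle$ generated by $\mathcal{C}$ is solvable. -/

import Mathlib

open Subgroup
open scoped Pointwise IsMulCommutative

universe u

/-! ### Residuals and their iteration along a word of primes. -/

namespace Subgroup

variable {G G' : Type*} [Group G] [Group G']

/-! By induction on the order of `G`, it suffices to find `u ≠ 1` whose normal closure is an
`r`-group: that subgroup is soluble and can be factored out. By Baer–Suzuki, it is enough that `u`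
generates an `r`-group with each of its conjugates. Replace the given element by a power `z` of
prime order `p`. Among the words `w` not killing all subgroups generated by seven conjugates of `z`,
one minimizing the total size of the residuals makes all these residuals `r`-groups for a single `r`
(`exists_isPGroup_iteratedResidual`). If `p` is not in `w`, residuals change nothing and `u = z`
works. Otherwise five conjugates `c` already have a nontrivial residual
(`exists_five_iteratedResidual_ne_bot`), not centralized by some `c j` by a transfer argument. Take
`u = [v, c j] ≠ 1` with `v` in the residual: the five conjugates put `u` in the residual of the
enlarged group, and two more conjugates put `g * u * g⁻¹` in that group. The residual is a normal
`r`-subgroup, so `u` and its conjugate generate an `r`-group.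

The number five comes from linear algebra. A minimal counterexample yields `H`, generated by five
conjugates of `x`, acting irreducibly on an abelian group `V` of order prime to `r`. Conjugating the
five generators independently by elements of `V` always leaves the residual an `r`-group, so Sylow's
theorem makes the five conjugations simultaneous. This forces `|V : C_V(x)| ^ 5 ≤ |V|`, against `|V|
≤ |V : C_V(x)| ^ 4` (`card_le_index_fixedAddSubgroup_pow_four`). -/

/-- The subgroup generated by the elements of `H` of order prime to `p`; for a finite group it is
the smallest normal subgroup of `H` whose quotient is a `p`-group. -/
def pResidual (p : Nat.Primes) (H : Subgroup G) : Subgroup G :=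
  closure {h | h ∈ H ∧ (orderOf h).Coprime p}

/-- The iteration of `pResidual` along a list of primes; the head of the list acts last. -/
def iteratedResidual : List Nat.Primes → Subgroup G → Subgroup G
  | [], H => H
  | p :: w, H => pResidual p (iteratedResidual w H)

theorem pResidual_le (p : Nat.Primes) (H : Subgroup G) : pResidual p H ≤ H :=
  (closure_le _).2 fun _ h => h.1

theorem mem_pResidual {p : Nat.Primes} {H : Subgroup G} {h : G} (hh : h ∈ H)
    (hp : (orderOf h).Coprime p) : h ∈ pResidual p H :=
  subset_closure ⟨hh, hp⟩

theorem pResidual_mono (p : Nat.Primes) {H K : Subgroup G} (h : H ≤ K) :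
    pResidual p H ≤ pResidual p K :=
  closure_mono fun _ hx => ⟨h hx.1, hx.2⟩

theorem pResidual_pResidual (p : Nat.Primes) (H : Subgroup G) :
    pResidual p (pResidual p H) = pResidual p H :=
  le_antisymm (pResidual_le _ _)
    ((closure_le _).2 fun _ h => mem_pResidual (mem_pResidual h.1 h.2) h.2)

theorem iteratedResidual_le (w : List Nat.Primes) (H : Subgroup G) : iteratedResidual w H ≤ H := by
  induction w with
  | nil => exact le_rfl
  | cons p w ih => exact (pResidual_le _ _).trans ih

theorem iteratedResidual_mono (w : List Nat.Primes) {H K : Subgroup G} (h : H ≤ K) :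
    iteratedResidual w H ≤ iteratedResidual w K := by
  induction w with
  | nil => exact h
  | cons p w ih => exact pResidual_mono p ih

theorem iteratedResidual_append (w₁ w₂ : List Nat.Primes) (H : Subgroup G) :
    iteratedResidual (w₁ ++ w₂) H = iteratedResidual w₁ (iteratedResidual w₂ H) := by
  induction w₁ with
  | nil => rfl
  | cons p w ih => simp only [List.cons_append, iteratedResidual, ih]

theorem exists_pow_coprime_orderOf [Finite G] (p : Nat.Primes) (h : G) :
    ∃ a : ℕ, (orderOf (h ^ (p : ℕ) ^ a)).Coprime p := by
  have hp := p.2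
  obtain ⟨a, m, hm, h0⟩ := Nat.exists_eq_pow_mul_and_not_dvd (orderOf_pos h).ne' (p : ℕ) hp.ne_one
  refine ⟨a, ?_⟩
  have hpos : 0 < (p : ℕ) ^ a := pow_pos hp.pos a
  rw [orderOf_pow_of_dvd hpos.ne' (h0 ▸ dvd_mul_right _ _), h0, Nat.mul_div_cancel_left _ hpos]
  exact ((Nat.Prime.coprime_iff_not_dvd hp).2 hm).symm

/-- An element of order prime to `p` in the image lifts to one: a `p`-power of any lift has order
prime to `p`, and a further power undoes this in the image. -/
theorem map_pResidual [Finite G] (p : Nat.Primes) (f : G →* G') (H : Subgroup G) :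
    (pResidual p H).map f = pResidual p (H.map f) := by
  apply le_antisymm
  · rw [map_le_iff_le_comap]
    refine (closure_le _).2 fun h hh => mem_pResidual (mem_map_of_mem f hh.1) ?_
    exact Nat.Coprime.coprime_dvd_left (orderOf_map_dvd f h) hh.2
  · refine (closure_le _).2 ?_
    rintro _ ⟨⟨h, hh, rfl⟩, hc⟩
    obtain ⟨a, ha⟩ := exists_pow_coprime_orderOf p h
    have h1 : (orderOf (f h)).Coprime ((p : ℕ) ^ a) := hc.pow_right a
    obtain ⟨k, hk⟩ := exists_pow_eq_self_of_coprime h1.symm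
    refine ⟨(h ^ (p : ℕ) ^ a) ^ k, pow_mem (mem_pResidual (pow_mem hh _) ha) _, ?_⟩
    rw [map_pow, map_pow, hk]

theorem map_iteratedResidual [Finite G] (w : List Nat.Primes) (f : G →* G') (H : Subgroup G) :
    (iteratedResidual w H).map f = iteratedResidual w (H.map f) := by
  induction w with
  | nil => rfl
  | cons p w ih => simp only [iteratedResidual, map_pResidual, ih]

theorem conj_mem_iteratedResidual [Finite G] (w : List Nat.Primes) {H : Subgroup G} {g x : G}
    (hg : ∀ h ∈ H, g * h * g⁻¹ ∈ H) (hx : x ∈ iteratedResidual w H) :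
    g * x * g⁻¹ ∈ iteratedResidual w H := by
  have h1 : H.map (MulAut.conj g).toMonoidHom ≤ H := by
    rintro _ ⟨h, hh, rfl⟩
    exact hg h hh
  refine iteratedResidual_mono w h1 ?_
  rw [← map_iteratedResidual]
  exact ⟨x, hx, rfl⟩

theorem conj_mem_iteratedResidual_of_mem [Finite G] (w : List Nat.Primes) {H : Subgroup G} {g x : G}
    (hg : g ∈ H) (hx : x ∈ iteratedResidual w H) : g * x * g⁻¹ ∈ iteratedResidual w H :=
  conj_mem_iteratedResidual w (fun _ hh => H.mul_mem (H.mul_mem hg hh) (H.inv_mem hg)) hx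

theorem normal_iteratedResidual [Finite G] (w : List Nat.Primes) {H : Subgroup G} (hH : H.Normal) :
    (iteratedResidual w H).Normal :=
  ⟨fun _ hx g => conj_mem_iteratedResidual w (fun h hh => hH.conj_mem h hh g) hx⟩

theorem pResidual_eq_bot_iff [Finite G] (p : Nat.Primes) (H : Subgroup G) :
    pResidual p H = ⊥ ↔ IsPGroup p H := by
  have : Fact (p : ℕ).Prime := ⟨p.2⟩
  constructor
  · rintro h ⟨x, hx⟩
    obtain ⟨a, ha⟩ := exists_pow_coprime_orderOf p x
    refine ⟨a, Subtype.ext ?_⟩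
    have := mem_pResidual (pow_mem hx _) ha
    rw [h, mem_bot] at this
    simpa using this
  · intro h
    refine (eq_bot_iff_forall _).2 fun x hx => ?_
    have : pResidual p H ≤ ⊥ := by
      refine (closure_le _).2 fun y hy => ?_
      obtain ⟨k, hk⟩ := h ⟨y, hy.1⟩
      have hk' : y ^ (p : ℕ) ^ k = 1 := by simpa using congrArg Subtype.val hk
      have h1 : orderOf y ∣ (p : ℕ) ^ k := orderOf_dvd_of_pow_eq_one hk'
      have h2 : orderOf y = 1 := Nat.Coprime.eq_one_of_dvd (hy.2.pow_right k) h1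
      simpa using orderOf_eq_one_iff.1 h2
    simpa using this hx

theorem isPGroup_map_of_pResidual_le_ker [Finite G] (p : Nat.Primes) (f : G →* G') (H : Subgroup G)
    (h : pResidual p H ≤ f.ker) : IsPGroup p (H.map f) := by
  rintro ⟨_, x, hx, rfl⟩
  obtain ⟨a, ha⟩ := exists_pow_coprime_orderOf p x
  refine ⟨a, Subtype.ext ?_⟩
  have := h (mem_pResidual (pow_mem hx _) ha)
  rw [MonoidHom.mem_ker, map_pow] at this
  simpa using this

/-- Modulo the join of the residuals each `A i` becomes a normal `p`-subgroup, and a join of those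
is a `p`-group. -/
theorem pResidual_iSup_le [Finite G] {ι : Type*} (p : Nat.Primes) (A : ι → Subgroup G)
    (hA : ∀ i, (A i).Normal) : pResidual p (⨆ i, A i) ≤ ⨆ i, pResidual p (A i) := by
  have hN : (⨆ i, pResidual p (A i)).Normal :=
    have := fun i => normal_iteratedResidual [p] (hA i)
    iSup_normal (fun i => iteratedResidual [p] (A i))
  set f := QuotientGroup.mk' (⨆ i, pResidual p (A i)) with hf
  have h1 : ∀ i, IsPGroup p ((A i).map f) := fun i =>
    isPGroup_map_of_pResidual_le_ker p f (A i) <| by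
      rw [hf, QuotientGroup.ker_mk']
      exact le_iSup (fun i => pResidual p (A i)) i
  have h2 : IsPGroup p ((⨆ i, A i).map f) := by
    rw [map_iSup]
    have : ∀ i, ((A i).map f).Normal := fun i =>
      (hA i).map f (QuotientGroup.mk'_surjective _)
    exact Sylow.iSup_of_normal _ h1
  rw [← pResidual_eq_bot_iff, ← map_pResidual, map_eq_bot_iff, hf, QuotientGroup.ker_mk'] at h2
  exact h2

theorem iteratedResidual_iSup_le [Finite G] {ι : Type*} (w : List Nat.Primes) (A : ι → Subgroup G)
    (hA : ∀ i, (A i).Normal) : iteratedResidual w (⨆ i, A i) ≤ ⨆ i, iteratedResidual w (A i) := by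
  induction w with
  | nil => exact le_rfl
  | cons p w ih =>
    exact (pResidual_mono p ih).trans
      (pResidual_iSup_le p _ fun i => normal_iteratedResidual w (hA i))

/-- Take `p` dividing the order of the abelianization. If the residual were `M`, elements of order
prime to `p` would generate the abelianization, so its exponent would be prime to `p`, against
Cauchy. -/
theorem exists_pResidual_lt [Finite G] {M : Subgroup G} [Group.IsSolvable M] (hM : M ≠ ⊥) :
    ∃ p : Nat.Primes, pResidual p M < M := by
  have : Nontrivial M := (nontrivial_iff_ne_bot M).2 hM
  have hlt := Group.IsSolvable.commutator_lt_top_of_nontrivial M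
  have hne : Nat.card (Abelianization M) ≠ 1 := by
    intro h
    have : (_root_.commutator M).index = 1 := h
    exact hlt.ne (index_eq_one.1 this)
  obtain ⟨p, hp, hdvd⟩ := Nat.exists_prime_and_dvd hne
  let q : Nat.Primes := ⟨p, hp⟩
  refine ⟨q, lt_of_le_of_ne (pResidual_le _ _) fun heq => ?_⟩
  have : Fact p.Prime := ⟨hp⟩
  obtain ⟨a, m, hm, h0⟩ :=
    Nat.exists_eq_pow_mul_and_not_dvd (n := Nat.card (Abelianization M)) Nat.card_pos.ne' p hp.ne_one
  have h1 : pResidual q (⊤ : Subgroup M) = ⊤ := by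
    apply map_injective M.subtype_injective
    rw [map_pResidual, ← MonoidHom.range_eq_map, range_subtype, heq]
  have h2 : pResidual q (⊤ : Subgroup (Abelianization M)) = ⊤ := by
    have h3 := map_pResidual q (Abelianization.of (G := M)) ⊤
    have h4 : (⊤ : Subgroup M).map (Abelianization.of (G := M)) = ⊤ :=
      map_top_of_surjective _ (QuotientGroup.mk'_surjective _)
    rw [h1, h4] at h3
    exact h3.symm
  have h3 : (⊤ : Subgroup (Abelianization M)) ≤ (powMonoidHom m).ker := by
    rw [← h2]
    refine (closure_le _).2 fun y hy => ?_
    have h5 : orderOf y ∣ p ^ a * m := h0 ▸ _root_.orderOf_dvd_natCard y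
    have h6 : orderOf y ∣ m := Nat.Coprime.dvd_of_dvd_mul_left (hy.2.pow_right a) h5
    exact orderOf_dvd_iff_pow_eq_one.1 h6
  obtain ⟨y, hy⟩ := exists_prime_orderOf_dvd_card' p hdvd
  exact hm (hy ▸ orderOf_dvd_iff_pow_eq_one.2 (h3 (mem_top y)))

theorem not_dvd_index_iteratedResidual [Finite G] {p : Nat.Primes} {w : List Nat.Primes}
    (hw : p ∉ w) {H : Subgroup G} : ¬ (p : ℕ) ∣ (iteratedResidual w H).relIndex H := by
  have : Fact (p : ℕ).Prime := ⟨p.2⟩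
  induction w with
  | nil => simpa [iteratedResidual] using p.2.ne_one
  | cons q w ih =>
    rw [List.mem_cons, not_or] at hw
    intro hd
    set M := iteratedResidual w H with hM
    have h1 : pResidual q M ≤ M := pResidual_le _ _
    rw [iteratedResidual, ← relIndex_mul_relIndex _ _ _ h1 (iteratedResidual_le w H)] at hd
    rcases (Nat.Prime.dvd_mul p.2).1 hd with hd | hd
    · have hn : ((pResidual q M).subgroupOf M).Normal := by
        refine ⟨fun x hx g => ?_⟩
        exact conj_mem_iteratedResidual_of_mem [q] g.2 hx
      have h2 : IsPGroup q ((⊤ : Subgroup M).map (QuotientGroup.mk' ((pResidual q M).subgroupOf M))) := by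
        apply isPGroup_map_of_pResidual_le_ker
        rw [QuotientGroup.ker_mk', subgroupOf, ← map_le_iff_le_comap, map_pResidual,
          ← MonoidHom.range_eq_map, range_subtype]
      rw [map_top_of_surjective _ (QuotientGroup.mk'_surjective _)] at h2
      obtain ⟨y, hy⟩ := exists_prime_orderOf_dvd_card' (G := M ⧸ (pResidual q M).subgroupOf M) p hd
      obtain ⟨k, hk⟩ := h2 ⟨y, mem_top y⟩
      have hk' : y ^ (q : ℕ) ^ k = 1 := by simpa using congrArg Subtype.val hk
      have h3 : (p : ℕ) ∣ q := p.2.dvd_of_dvd_pow (hy ▸ orderOf_dvd_of_pow_eq_one hk')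
      exact hw.1 (Subtype.ext ((Nat.prime_dvd_prime_iff_eq p.2 q.2).1 h3))
    · exact ih hw.2 hd

end Subgroup

/-! ### The Baer–Suzuki theorem. -/

section BaerSuzuki

variable {G : Type*} [Group G] [Finite G] {p : ℕ} [Fact p.Prime]

theorem exists_lt_le_forall_conj_mem {P A : Subgroup G} (hP : IsPGroup p P) (hA : A < P) :
    ∃ B : Subgroup G, A < B ∧ B ≤ P ∧ ∀ b ∈ B, ∀ a ∈ A, b * a * b⁻¹ ∈ A := by
  have hn : Group.IsNilpotent P := hP.isNilpotent
  have h1 : A.subgroupOf P < ⊤ := by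
    rw [lt_top_iff_ne_top, Ne, subgroupOf_eq_top]
    exact hA.not_ge
  have h2 := Group.normalizerCondition_of_isNilpotent (A.subgroupOf P) h1
  refine ⟨(normalizer (A.subgroupOf P : Set P)).map P.subtype, ?_, map_subtype_le _, ?_⟩
  · have h3 := (map_lt_map_iff_of_injective P.subtype_injective).2 h2
    rwa [map_subgroupOf_eq_of_le hA.le] at h3
  · rintro _ ⟨b, hb, rfl⟩ a ha
    exact (mem_normalizer_iff.1 hb ⟨a, hA.le ha⟩).1 ha

/-- Let `B` be maximal between `A` and `P` with `B ∩ K ⊆ A`. A strictly larger subgroup normalizing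
`B` contains a new member of `K`, which conjugates `A ∩ K` into `B ∩ K ⊆ A`. -/
theorem exists_mem_notMem_forall_conj_mem {P A : Subgroup G} (hP : IsPGroup p P) {K : Set G}
    (hK : ∀ g, ∀ k ∈ K, g * k * g⁻¹ ∈ K) (hA : A ≤ P) (hne : ∃ x ∈ P, x ∈ K ∧ x ∉ A) :
    ∃ a ∈ P, a ∈ K ∧ a ∉ A ∧ ∀ d ∈ A, d ∈ K → a * d * a⁻¹ ∈ A := by
  obtain ⟨B, hB⟩ := Set.Finite.exists_maximal
    (s := {B : Subgroup G | A ≤ B ∧ B ≤ P ∧ ∀ x ∈ B, x ∈ K → x ∈ A}) (Set.toFinite _)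
    ⟨A, le_rfl, hA, fun x hx _ => hx⟩
  obtain ⟨hAB, hBP, hBK⟩ := hB.1
  obtain ⟨x, hxP, hxK, hxA⟩ := hne
  have hlt : B < P := lt_of_le_of_ne hBP fun h => hxA (hBK x (h ▸ hxP) hxK)
  obtain ⟨B', hBB', hB'P, hB'⟩ := exists_lt_le_forall_conj_mem hP hlt
  have hex : ∃ a ∈ B', a ∈ K ∧ a ∉ A := by
    by_contra! h
    exact hBB'.not_ge (hB.2 ⟨hAB.trans hBB'.le, hB'P, h⟩ hBB'.le)
  obtain ⟨a, haB', haK, haA⟩ := hex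
  exact ⟨a, hB'P haB', haK, haA, fun d hd hdK => hBK _ (hB' a haB' d (hAB hd)) (hK a d hdK)⟩

/-- The **Baer–Suzuki theorem**. -/
theorem isPGroup_normalClosure_of_forall_isPGroup_closure_pair (u : G)
    (hu : ∀ g : G, IsPGroup p (closure {u, g * u * g⁻¹})) :
    IsPGroup p (normalClosure {u}) := by
  set K : Set G := Group.conjugatesOfSet {u} with hKdef
  have hK : ∀ g, ∀ k ∈ K, g * k * g⁻¹ ∈ K := fun g k hk => Group.conj_mem_conjugatesOfSet hk
  have hKmem : ∀ k ∈ K, ∃ g, k = g * u * g⁻¹ := by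
    intro k hk
    obtain ⟨a, ha, hc⟩ := Group.mem_conjugatesOfSet_iff.1 hk
    rw [Set.mem_singleton_iff.1 ha] at hc
    obtain ⟨g, hg⟩ := isConj_iff.1 hc
    exact ⟨g, hg.symm⟩
  have hpair : ∀ a ∈ K, ∀ b ∈ K, IsPGroup p (closure {a, b}) := by
    intro a ha b hb
    obtain ⟨g, rfl⟩ := hKmem a ha
    obtain ⟨h, rfl⟩ := hKmem b hb
    have := (hu (g⁻¹ * h)).map (MulAut.conj g).toMonoidHom
    rw [MonoidHom.map_closure, Set.image_pair] at this
    have e : (MulAut.conj g).toMonoidHom (g⁻¹ * h * u * (g⁻¹ * h)⁻¹) = h * u * h⁻¹ := by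
      simp [mul_assoc]
    rwa [e] at this
  -- Conjugate Sylow subgroups meet `K` in equally many elements, so an inclusion is an equality.
  have hcard : ∀ P Q : Sylow p G, (∀ x ∈ P, x ∈ K → x ∈ Q) → ∀ x ∈ Q, x ∈ K → x ∈ P := by
    intro P Q h x hxQ hxK
    obtain ⟨g, hg⟩ := MulAction.exists_smul_eq G P Q
    have hQP : ∀ y, g * y * g⁻¹ ∈ Q ↔ y ∈ P := by
      intro y
      have : MulAut.conj g • y ∈ MulAut.conj g • (P : Subgroup G) ↔ y ∈ (P : Subgroup G) :=
        smul_mem_pointwise_smul_iff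
      rw [← hg]
      exact this
    have h1 : Set.ncard {x | x ∈ Q ∧ x ∈ K} ≤ Set.ncard {x | x ∈ P ∧ x ∈ K} := by
      refine Set.ncard_le_ncard_of_injOn (fun y => g⁻¹ * y * g) ?_ ?_
      · rintro y ⟨hy, hyK⟩
        refine ⟨(hQP _).1 (by simpa [mul_assoc] using hy), ?_⟩
        simpa using hK g⁻¹ y hyK
      · intro a _ b _ hab
        simpa using hab
    have h2 := Set.eq_of_subset_of_ncard_le
      (s := {x | x ∈ P ∧ x ∈ K}) (t := {x | x ∈ Q ∧ x ∈ K}) (fun x hx => ⟨h x hx.1 hx.2, hx.2⟩) h1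
    have h3 : x ∈ {x | x ∈ P ∧ x ∈ K} := h2 ▸ ⟨hxQ, hxK⟩
    exact h3.1
  by_cases hall : ∀ P Q : Sylow p G, ∀ x ∈ P, x ∈ K → x ∈ Q
  · obtain ⟨P⟩ : Nonempty (Sylow p G) := inferInstance
    refine P.isPGroup'.to_le ((closure_le _).2 fun x hx => ?_)
    have h1 := hpair x hx x hx
    obtain ⟨Q, hQ⟩ := h1.exists_le_sylow
    exact hall Q P x (hQ (subset_closure (by simp))) hx
  · exfalso
    push Not at hall
    obtain ⟨P₀, Q₀, hPQ₀⟩ := hall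
    -- Two Sylow subgroups with different traces on `K` and the largest common trace `D`. Elements
    -- `a` of `P` and `b` of `Q` outside `closure D` normalize it, so some Sylow `S` contains `D`,
    -- `a` and `b`; maximality applied to `(P, S)` and `(S, Q)` then carries the trace of `P` into
    -- `Q`.
    obtain ⟨⟨P, Q⟩, hmem, hmax⟩ := Set.exists_max_image
      {PQ : Sylow p G × Sylow p G | ∃ x ∈ PQ.1, x ∈ K ∧ x ∉ PQ.2}
      (fun PQ => Set.ncard {x | x ∈ PQ.1 ∧ x ∈ PQ.2 ∧ x ∈ K}) (Set.toFinite _) ⟨(P₀, Q₀), hPQ₀⟩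
    have hmem' : ∃ x ∈ Q, x ∈ K ∧ x ∉ P := by
      by_contra! h
      obtain ⟨x, hxP, hxK, hxQ⟩ := hmem
      exact hxQ (hcard Q P h x hxP hxK)
    set D : Set G := {x | x ∈ P ∧ x ∈ Q ∧ x ∈ K} with hD
    have hDP : closure D ≤ P := (closure_le _).2 fun x hx => hx.1
    have hDQ : closure D ≤ Q := (closure_le _).2 fun x hx => hx.2.1
    obtain ⟨a, haP, haK, haD, han⟩ := exists_mem_notMem_forall_conj_mem P.isPGroup' hK hDP
      (by obtain ⟨x, hxP, hxK, hxQ⟩ := hmem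
          exact ⟨x, hxP, hxK, fun h => hxQ (hDQ h)⟩)
    obtain ⟨b, hbQ, hbK, hbD, hbn⟩ := exists_mem_notMem_forall_conj_mem Q.isPGroup' hK hDQ
      (by obtain ⟨x, hxP, hxK, hxQ⟩ := hmem'
          exact ⟨x, hxP, hxK, fun h => hxQ (hDP h)⟩)
    have hnorm : closure {a, b} ≤ normalizer (closure D : Set G) := by
      have key : ∀ c, (∀ d ∈ closure D, d ∈ K → c * d * c⁻¹ ∈ closure D) →
          c ∈ normalizer (closure D : Set G) := by
        intro c hc
        have hle : (closure D).map (MulAut.conj c).toMonoidHom ≤ closure D := by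
          rw [MonoidHom.map_closure, closure_le]
          rintro _ ⟨d, hd, rfl⟩
          exact hc d (subset_closure hd) hd.2.2
        rw [mem_normalizer_iff_map_conj_eq]
        refine eq_of_le_of_card_ge hle ?_
        exact (Nat.card_congr ((closure D).equivMapOfInjective _
          (MulAut.conj c).injective).toEquiv).le
      refine (closure_le _).2 ?_
      rintro c (rfl | rfl)
      · exact key _ han
      · exact key _ hbn
    have hS := (hpair a haK b hbK).to_sup_of_normal_right' (P.isPGroup'.to_le hDP) hnorm
    obtain ⟨S, hS⟩ := hS.exists_le_sylow
    have haS : a ∈ S := hS (mem_sup_left (subset_closure (by simp)))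
    have hbS : b ∈ S := hS (mem_sup_left (subset_closure (by simp)))
    have hDS : ∀ x ∈ D, x ∈ S := fun x hx => hS (mem_sup_right (subset_closure hx))
    have hbig : ∀ (R T : Sylow p G) (c : G), c ∈ K → c ∉ closure D → c ∈ R → c ∈ T →
        (∀ x ∈ D, x ∈ R) → (∀ x ∈ D, x ∈ T) → ∀ x ∈ R, x ∈ K → x ∈ T := by
      intro R T c hcK hcD hcR hcT hDR hDT
      by_contra! h
      have h1 := hmax (R, T) h
      have h2 : D ⊂ {x | x ∈ R ∧ x ∈ T ∧ x ∈ K} := by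
        refine ⟨fun x hx => ⟨hDR x hx, hDT x hx, hx.2.2⟩, fun h => ?_⟩
        exact hcD (subset_closure (h ⟨hcR, hcT, hcK⟩))
      exact (Set.ncard_lt_ncard h2).not_ge h1
    obtain ⟨x, hxP, hxK, hxQ⟩ := hmem
    have h1 := hbig P S a haK haD haP haS (fun x hx => hx.1) hDS x hxP hxK
    exact hxQ (hbig S Q b hbK hbD hbS hbQ hDS (fun x hx => hx.2.1) x h1 hxK)

end BaerSuzuki

/-! ### Block systems encoded by idempotents. -/

section BlockIdempotent

variable {R : Type*} [Ring R] {H : Type*} [Group H] (c : H →* RingAut R)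

/-- A nontrivial idempotent all of whose conjugates are equal or orthogonal to it: the projection
onto one summand of a direct decomposition that is permuted by `H`. -/
structure IsBlockIdempotent (e : R) : Prop where
  ne_zero : e ≠ 0
  ne_one : e ≠ 1
  idem : e * e = e
  orth : ∀ h, c h e = e ∨ (c h e * e = 0 ∧ e * c h e = 0)

variable [Finite R]

/-- The right ideal `eR` lies in `fR`; equality of sizes puts `f` in `eR`. -/
theorem eq_of_card_mul_eq_self_le {e f : R} (hf : f * f = f) (hfe : f * e = e) (hef : e * f = e)
    (h : Nat.card {a : R // f * a = a} ≤ Nat.card {a : R // e * a = a}) : f = e := by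
  have h1 : {a : R | e * a = a} ⊆ {a : R | f * a = a} := by
    intro a ha
    have ha' : e * a = a := ha
    change f * a = a
    rw [← ha', ← mul_assoc, hfe]
  have h2 := Set.eq_of_subset_of_ncard_le h1 h
  have h3 : f ∈ {a : R | e * a = a} := h2 ▸ hf
  exact (show e * f = f from h3).symm.trans hef

/-- The finite set of the conjugates of `e` under `T`. -/
noncomputable def conjOrbit (T : Subgroup H) (e : R) : Finset R :=
  (Set.toFinite {ω | ∃ t ∈ T, c t e = ω}).toFinset

theorem mem_conjOrbit {T : Subgroup H} {e ω : R} : ω ∈ conjOrbit c T e ↔ ∃ t ∈ T, c t e = ω := by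
  simp [conjOrbit]

variable {c}

theorem self_mem_conjOrbit {T : Subgroup H} {e : R} : e ∈ conjOrbit c T e :=
  (mem_conjOrbit c).2 ⟨1, T.one_mem, by simp⟩

theorem conj_mem_conjOrbit {T : Subgroup H} {e ω : R} {t : H} (ht : t ∈ T)
    (h : ω ∈ conjOrbit c T e) : c t ω ∈ conjOrbit c T e := by
  obtain ⟨s, hs, rfl⟩ := (mem_conjOrbit c).1 h
  exact (mem_conjOrbit c).2 ⟨t * s, T.mul_mem ht hs, by simp⟩

theorem conjOrbit_eq_of_mem {T : Subgroup H} {e ω : R} (h : ω ∈ conjOrbit c T e) :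
    conjOrbit c T ω = conjOrbit c T e := by
  obtain ⟨s, hs, rfl⟩ := (mem_conjOrbit c).1 h
  ext a
  rw [mem_conjOrbit, mem_conjOrbit]
  constructor
  · rintro ⟨t, ht, rfl⟩
    exact ⟨t * s, T.mul_mem ht hs, by simp⟩
  · rintro ⟨t, ht, rfl⟩
    refine ⟨t * s⁻¹, T.mul_mem ht (T.inv_mem hs), ?_⟩
    rw [← RingAut.mul_apply, ← map_mul, inv_mul_cancel_right]

theorem conjOrbit_mono {S T : Subgroup H} (h : S ≤ T) (e : R) :
    conjOrbit c S e ⊆ conjOrbit c T e := by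
  intro a ha
  obtain ⟨t, ht, rfl⟩ := (mem_conjOrbit c).1 ha
  exact (mem_conjOrbit c).2 ⟨t, h ht, rfl⟩

theorem map_sum_conjOrbit {T : Subgroup H} (hT : T.Normal) (h : H) (e : R) :
    c h (∑ ω ∈ conjOrbit c T e, ω) = ∑ ω ∈ conjOrbit c T (c h e), ω := by
  rw [map_sum]
  refine Finset.sum_bij (fun ω _ => c h ω) ?_ (fun _ _ _ _ hab => (c h).injective hab) ?_
    (fun _ _ => rfl)
  · intro ω hω
    obtain ⟨t, ht, rfl⟩ := (mem_conjOrbit c).1 hω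
    refine (mem_conjOrbit c).2 ⟨h * t * h⁻¹, hT.conj_mem t ht h, ?_⟩
    simp only [← RingAut.mul_apply, ← map_mul, inv_mul_cancel_right]
  · intro ω hω
    obtain ⟨t, ht, rfl⟩ := (mem_conjOrbit c).1 hω
    refine ⟨c (h⁻¹ * t * h) e, (mem_conjOrbit c).2 ⟨_, ?_, rfl⟩, ?_⟩
    · simpa using hT.conj_mem t ht h⁻¹
    · simp only [← RingAut.mul_apply, ← map_mul]
      simp [mul_assoc]

namespace IsBlockIdempotent

variable {e : R}

theorem mul_eq_zero_of_ne (he : IsBlockIdempotent c e) {a b : R} (ha : a ∈ conjOrbit c ⊤ e)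
    (hb : b ∈ conjOrbit c ⊤ e) (hab : a ≠ b) : a * b = 0 := by
  obtain ⟨g, -, rfl⟩ := (mem_conjOrbit c).1 ha
  obtain ⟨h, -, rfl⟩ := (mem_conjOrbit c).1 hb
  have h1 : c g e = c h (c (h⁻¹ * g) e) := by
    rw [← RingAut.mul_apply, ← map_mul, mul_inv_cancel_left]
  rcases he.orth (h⁻¹ * g) with h2 | h2
  · exact absurd (h1.trans (congrArg (c h) h2)) hab
  · rw [h1, ← map_mul, h2.1, map_zero]

theorem idem_of_mem (he : IsBlockIdempotent c e) {a : R} (ha : a ∈ conjOrbit c ⊤ e) :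
    a * a = a := by
  obtain ⟨g, -, rfl⟩ := (mem_conjOrbit c).1 ha
  rw [← map_mul, he.idem]

theorem sum_mul_eq_self (he : IsBlockIdempotent c e) {S : Finset R} (hS : S ⊆ conjOrbit c ⊤ e)
    {a : R} (ha : a ∈ S) : (∑ ω ∈ S, ω) * a = a := by
  rw [Finset.sum_mul, Finset.sum_eq_single a]
  · exact he.idem_of_mem (hS ha)
  · intro b hb hba
    exact he.mul_eq_zero_of_ne (hS hb) (hS ha) hba
  · exact fun h => absurd ha h

theorem mul_sum_eq_self (he : IsBlockIdempotent c e) {S : Finset R} (hS : S ⊆ conjOrbit c ⊤ e)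
    {a : R} (ha : a ∈ S) : a * (∑ ω ∈ S, ω) = a := by
  rw [Finset.mul_sum, Finset.sum_eq_single a]
  · exact he.idem_of_mem (hS ha)
  · intro b hb hba
    exact he.mul_eq_zero_of_ne (hS ha) (hS hb) hba.symm
  · exact fun h => absurd ha h

theorem sum_idem (he : IsBlockIdempotent c e) {S : Finset R} (hS : S ⊆ conjOrbit c ⊤ e) :
    (∑ ω ∈ S, ω) * (∑ ω ∈ S, ω) = ∑ ω ∈ S, ω := by
  rw [Finset.mul_sum]
  exact Finset.sum_congr rfl fun a ha => he.sum_mul_eq_self hS ha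

theorem sum_ne_zero (he : IsBlockIdempotent c e) (T : Subgroup H) :
    ∑ ω ∈ conjOrbit c T e, ω ≠ 0 := fun h => he.ne_zero <| by
  rw [← he.sum_mul_eq_self (conjOrbit_mono le_top e) self_mem_conjOrbit, h, zero_mul]

/-- Orbits of a normal subgroup are themselves permuted, so merging the blocks of each orbit gives a
coarser block system. -/
theorem sum_conjOrbit (he : IsBlockIdempotent c e) {T : Subgroup H} (hT : T.Normal)
    (h1 : ∑ ω ∈ conjOrbit c T e, ω ≠ 1) : IsBlockIdempotent c (∑ ω ∈ conjOrbit c T e, ω) := by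
  refine ⟨he.sum_ne_zero T, h1, he.sum_idem (conjOrbit_mono le_top e), fun h => ?_⟩
  rw [map_sum_conjOrbit hT]
  by_cases hm : c h e ∈ conjOrbit c T e
  · exact Or.inl (by rw [conjOrbit_eq_of_mem hm])
  · right
    have hne : ∀ a ∈ conjOrbit c T (c h e), ∀ b ∈ conjOrbit c T e, a ≠ b := by
      rintro a ha _ hb rfl
      refine hm ?_
      rw [← conjOrbit_eq_of_mem hb, conjOrbit_eq_of_mem ha]
      exact self_mem_conjOrbit
    have hA : ∀ a ∈ conjOrbit c T (c h e), a ∈ conjOrbit c ⊤ e := by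
      intro a ha
      have := conjOrbit_mono (c := c) (le_top : T ≤ ⊤) (c h e) ha
      rwa [conjOrbit_eq_of_mem (conj_mem_conjOrbit (mem_top h) self_mem_conjOrbit)] at this
    have hB : ∀ b ∈ conjOrbit c T e, b ∈ conjOrbit c ⊤ e := conjOrbit_mono le_top e
    constructor
    · rw [Finset.sum_mul_sum]
      exact Finset.sum_eq_zero fun a ha => Finset.sum_eq_zero fun b hb =>
        he.mul_eq_zero_of_ne (hA a ha) (hB b hb) (hne a ha b hb)
    · rw [Finset.sum_mul_sum]
      exact Finset.sum_eq_zero fun b hb => Finset.sum_eq_zero fun a ha =>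
        he.mul_eq_zero_of_ne (hB b hb) (hA a ha) (hne a ha b hb).symm

/-- A block idempotent of maximal size: the sum of its conjugates under a normal subgroup is
either `1` or the idempotent itself. -/
theorem exists_maximal (he : IsBlockIdempotent c e) :
    ∃ e : R, IsBlockIdempotent c e ∧ ∀ T : Subgroup H, T.Normal →
      ∑ ω ∈ conjOrbit c T e, ω = 1 ∨ ∑ ω ∈ conjOrbit c T e, ω = e := by
  obtain ⟨e, he, hmax⟩ := Set.exists_max_image {e : R | IsBlockIdempotent c e}
    (fun e => Nat.card {a : R // e * a = a}) (Set.toFinite _) ⟨e, he⟩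
  refine ⟨e, he, fun T hT => or_iff_not_imp_left.2 fun h1 => ?_⟩
  have hb := he.sum_conjOrbit hT h1
  exact eq_of_card_mul_eq_self_le hb.idem
    (he.sum_mul_eq_self (conjOrbit_mono le_top e) self_mem_conjOrbit)
    (he.mul_sum_eq_self (conjOrbit_mono le_top e) self_mem_conjOrbit) (hmax _ hb)

end IsBlockIdempotent

/-- A minimal nonzero idempotent of an invariant commutative subring is a block idempotent. -/
theorem exists_isBlockIdempotent {S : Subring R} (hcomm : ∀ a ∈ S, ∀ b ∈ S, a * b = b * a)
    (hinv : ∀ h, ∀ a ∈ S, c h a ∈ S) {a : R} (ha : a ∈ S) (ha0 : a ≠ 0) (ha1 : a ≠ 1)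
    (haa : a * a = a) : ∃ e : R, IsBlockIdempotent c e := by
  obtain ⟨e, ⟨heS, he0, hee⟩, hmin⟩ := Set.exists_min_image {e : R | e ∈ S ∧ e ≠ 0 ∧ e * e = e}
    (fun e => Nat.card {a : R // e * a = a}) (Set.toFinite _) ⟨a, ha, ha0, haa⟩
  have hprod : ∀ f ∈ S, f * f = f → f * e = 0 ∨ f * e = e := by
    intro f hf hff
    by_cases h0 : f * e = 0
    · exact Or.inl h0
    · right
      have h1 : (f * e) * (f * e) = f * e := by
        rw [mul_assoc, ← mul_assoc e, hcomm e heS f hf, mul_assoc f e e, hee, ← mul_assoc, hff]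
      refine (eq_of_card_mul_eq_self_le hee ?_ ?_ (hmin _ ⟨S.mul_mem hf heS, h0, h1⟩)).symm
      · rw [← mul_assoc, hcomm e heS f hf, mul_assoc, hee]
      · rw [mul_assoc, hee]
  refine ⟨e, he0, ?_, hee, fun h => ?_⟩
  · rintro rfl
    rcases hprod a ha haa with h | h
    · exact ha0 (by simpa using h)
    · exact ha1 (by simpa using h)
  · have hS := hinv h e heS
    have hid : c h e * c h e = c h e := by rw [← map_mul, hee]
    rcases hprod _ hS hid with h0 | h0
    · exact Or.inr ⟨h0, (hcomm e heS _ hS).trans h0⟩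
    · left
      refine eq_of_card_mul_eq_self_le hid h0 ((hcomm e heS _ hS).trans h0) (le_of_eq ?_)
      refine Nat.card_congr (((c h).symm.toEquiv).subtypeEquiv fun b => ?_)
      change c h e * b = b ↔ e * (c h).symm b = (c h).symm b
      rw [← (c h).injective.eq_iff (a := e * (c h).symm b), map_mul, RingEquiv.apply_symm_apply]

end BlockIdempotent

/-! ### Indices of fixed-point subgroups. -/

section FixedPoints

variable (V : Type*) [AddCommGroup V] {H : Type*} [Group H] [DistribMulAction H V]

/-- The subgroup of elements fixed by `h`. -/
def fixedAddSubgroup (h : H) : AddSubgroup V where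
  carrier := {v | h • v = v}
  zero_mem' := smul_zero h
  add_mem' {a b} ha hb := by
    simp only [Set.mem_ofPred_eq] at *
    rw [smul_add, ha, hb]
  neg_mem' {a} ha := by
    simp only [Set.mem_ofPred_eq] at *
    rw [smul_neg, ha]

variable {V}

theorem mem_fixedAddSubgroup {h : H} {v : V} : v ∈ fixedAddSubgroup V h ↔ h • v = v := Iff.rfl

theorem index_fixedAddSubgroup_conj (g x : H) :
    (fixedAddSubgroup V (g * x * g⁻¹)).index = (fixedAddSubgroup V x).index := by
  have : fixedAddSubgroup V (g * x * g⁻¹) =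
      (fixedAddSubgroup V x).map (DistribMulAction.toAddEquiv V g : V →+ V) := by
    ext v
    rw [AddSubgroup.mem_map]
    constructor
    · intro hv
      refine ⟨g⁻¹ • v, ?_, by simp⟩
      rw [mem_fixedAddSubgroup] at hv ⊢
      conv_rhs => rw [← hv]
      simp [mul_smul]
    · rintro ⟨u, hu, rfl⟩
      rw [mem_fixedAddSubgroup] at hu ⊢
      simp [mul_smul, hu]
  rw [this]
  exact AddSubgroup.index_map_equiv _ _

/-- The commutator fixes whatever both `x` and its conjugate fix, and their fixed subgroups have the
same index. -/
theorem index_fixedAddSubgroup_commutator_le [Finite V] (g x : H) :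
    (fixedAddSubgroup V (g * x * g⁻¹ * x⁻¹)).index ≤ (fixedAddSubgroup V x).index ^ 2 := by
  have h0 : (fixedAddSubgroup V x).index ≠ 0 := AddSubgroup.index_ne_zero_of_finite
  have h1 : fixedAddSubgroup V (g * x * g⁻¹) ⊓ fixedAddSubgroup V x ≤
      fixedAddSubgroup V (g * x * g⁻¹ * x⁻¹) := by
    rintro v ⟨h1, h2⟩
    have h1' : (g * x * g⁻¹) • v = v := h1
    have h2' : x • v = v := h2
    rw [mem_fixedAddSubgroup, mul_smul, inv_smul_eq_iff.2 h2'.symm, h1']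
  have h2 : (fixedAddSubgroup V (g * x * g⁻¹) ⊓ fixedAddSubgroup V x).index ≠ 0 :=
    AddSubgroup.index_inf_ne_zero (by rwa [index_fixedAddSubgroup_conj]) h0
  calc (fixedAddSubgroup V (g * x * g⁻¹ * x⁻¹)).index
      ≤ (fixedAddSubgroup V (g * x * g⁻¹) ⊓ fixedAddSubgroup V x).index :=
        Nat.le_of_dvd (Nat.pos_of_ne_zero h2) (AddSubgroup.index_dvd_of_le h1)
    _ ≤ _ := AddSubgroup.index_inf_le
    _ = (fixedAddSubgroup V x).index ^ 2 := by rw [index_fixedAddSubgroup_conj, sq]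

end FixedPoints

/-! ### Elements that move every block. -/

section Linear

variable {V : Type*} [AddCommGroup V] {H : Type*} [Group H] [DistribMulAction H V]

variable (V H) in
/-- The conjugation action on the endomorphism ring. -/
def endConj : H →* RingAut (AddMonoid.End V) :=
  (MulSemiringAction.toRingAut (ConjAct (AddMonoid.End V)ˣ) (AddMonoid.End V)).comp
    ((ConjAct.toConjAct).toMonoidHom.comp (DistribMulAction.toAddMonoidEnd H V).toHomUnits)

theorem endConj_apply_apply (h : H) (e : AddMonoid.End V) (v : V) :
    endConj V H h e v = h • e (h⁻¹ • v) := rfl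

instance [Finite V] : Finite (AddMonoid.End V) :=
  Finite.of_injective (fun f : AddMonoid.End V => (f : V → V)) DFunLike.coe_injective

theorem eq_one_of_forall_endConj_eq
    (hirr : ∀ U : AddSubgroup V, (∀ (h : H), ∀ u ∈ U, h • u ∈ U) → U = ⊥ ∨ U = ⊤)
    {f : AddMonoid.End V} (hff : f * f = f) (hf0 : f ≠ 0) (hf : ∀ h : H, endConj V H h f = f) :
    f = 1 := by
  rcases hirr (AddMonoidHom.range f) (by
    rintro h _ ⟨v, rfl⟩
    refine ⟨h • v, ?_⟩
    calc f (h • v) = endConj V H h f (h • v) := by rw [hf h]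
      _ = h • f (h⁻¹ • h • v) := rfl
      _ = h • f v := by rw [inv_smul_smul]) with h | h
  · refine absurd (DFunLike.ext _ _ fun v => ?_) hf0
    have : f v ∈ AddMonoidHom.range f := ⟨v, rfl⟩
    rw [h] at this
    simpa using this
  · refine DFunLike.ext _ _ fun v => ?_
    have : v ∈ AddMonoidHom.range f := h ▸ AddSubgroup.mem_top v
    obtain ⟨w, rfl⟩ := this
    exact DFunLike.congr_fun hff w

theorem card_le_index_of_inf_eq_bot [Finite V] {A F : AddSubgroup V} (h : F ⊓ A = ⊥) :
    Nat.card A ≤ F.index := by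
  have h1 : F.relIndex A = Nat.card A := by
    rw [← AddSubgroup.inf_relIndex_right, h, AddSubgroup.relIndex_bot_left]
  rw [← h1]
  have h2 : F.relIndex ⊤ ≠ 0 := AddSubgroup.index_ne_zero_of_finite
  exact (AddSubgroup.relIndex_le_of_le_right le_top h2).trans_eq (AddSubgroup.relIndex_top_right F)

/-- A vector fixed by `y` is determined by its component in one block of each orbit of `y`. Let `f`
project onto a set of orbit representatives. Since `y` moves each representative off that set, the
fixed subgroup meets both `ker f` and `ker (1 - f)` trivially; each kernel thus has order at most
the index, and together they account for `V`. -/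
theorem card_le_index_sq_of_forall_endConj_ne [Finite V] {e : AddMonoid.End V}
    (he : IsBlockIdempotent (endConj V H) e) (hsum : ∑ ω ∈ conjOrbit (endConj V H) ⊤ e, ω = 1)
    {y : H} (hy : ∀ ω ∈ conjOrbit (endConj V H) ⊤ e, endConj V H y ω ≠ ω) :
    Nat.card V ≤ (fixedAddSubgroup V y).index ^ 2 := by
  classical
  set Ω := conjOrbit (endConj V H) ⊤ e with hΩ
  let Z := zpowers y
  -- The choice is made from the orbit as a set, so all members of an orbit get the same
  -- representative.
  let rep : AddMonoid.End V → AddMonoid.End V := fun ω =>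
    (⟨ω, self_mem_conjOrbit⟩ : (conjOrbit (endConj V H) Z ω).Nonempty).choose
  have hrep : ∀ ω, rep ω ∈ conjOrbit (endConj V H) Z ω := fun ω => Exists.choose_spec _
  have hrepeq : ∀ ω ω', ω' ∈ conjOrbit (endConj V H) Z ω → rep ω' = rep ω := by
    intro ω ω' h
    have h1 := conjOrbit_eq_of_mem h
    simp only [rep, h1]
  have hZΩ : ∀ ω ∈ Ω, ∀ ω' ∈ conjOrbit (endConj V H) Z ω, ω' ∈ Ω := by
    intro ω hω ω' h
    rw [hΩ, ← conjOrbit_eq_of_mem hω]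
    exact conjOrbit_mono le_top ω h
  set S := Ω.filter fun ω => rep ω = ω with hS
  have hSΩ : S ⊆ Ω := Finset.filter_subset _ _
  set f := ∑ ω ∈ S, ω with hf
  have hvan : ∀ v ∈ fixedAddSubgroup V y, ∀ ω ω', ω' ∈ conjOrbit (endConj V H) Z ω →
      ω' v = 0 → ω v = 0 := by
    intro v hv ω ω' h h0
    have hst : Z ≤ MulAction.stabilizer H v := by
      rw [zpowers_le]
      exact hv
    obtain ⟨z, hz, rfl⟩ := (mem_conjOrbit _).1 h
    have h1 : z⁻¹ • v = v := hst (Z.inv_mem hz)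
    rw [endConj_apply_apply, h1] at h0
    exact (smul_eq_zero_iff_eq z).1 h0
  have hzero : ∀ v, (∀ ω ∈ Ω, ω v = 0) → v = 0 := by
    intro v hv
    have h1 : (∑ ω ∈ Ω, ω) v = v := by rw [hsum]; rfl
    have h2 : (∑ ω ∈ Ω, ω) v = ∑ ω ∈ Ω, ω v := map_sum (AddMonoidHom.eval v) (fun ω => ω) Ω
    rw [← h1, h2]
    exact Finset.sum_eq_zero hv
  have hA : fixedAddSubgroup V y ⊓ AddMonoidHom.ker f = ⊥ := by
    refine (AddSubgroup.eq_bot_iff_forall _).2 fun v hv => hzero v fun ω hω => ?_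
    have hr := hrep ω
    refine hvan v hv.1 ω (rep ω) hr ?_
    have hrS : rep ω ∈ S := Finset.mem_filter.2 ⟨hZΩ ω hω _ hr, hrepeq _ _ hr⟩
    rw [← he.mul_sum_eq_self hSΩ hrS]
    change rep ω (f v) = 0
    rw [show f v = 0 from hv.2, map_zero]
  have hB : fixedAddSubgroup V y ⊓ AddMonoidHom.ker (1 - f) = ⊥ := by
    refine (AddSubgroup.eq_bot_iff_forall _).2 fun v hv => hzero v fun ω hω => ?_
    have hr := hrep ω
    have hr' : endConj V H y (rep ω) ∈ conjOrbit (endConj V H) Z ω :=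
      conj_mem_conjOrbit (mem_zpowers y) hr
    refine hvan v hv.1 ω _ hr' ?_
    have hnS : endConj V H y (rep ω) ∉ S := by
      intro h
      have h1 := (Finset.mem_filter.1 h).2
      rw [hrepeq _ _ hr'] at h1
      exact hy _ (hZΩ ω hω _ hr) h1.symm
    have hv2 : f v = v := (sub_eq_zero.1 (show v - f v = 0 from hv.2)).symm
    have h0 : endConj V H y (rep ω) * f = 0 := by
      rw [hf, Finset.mul_sum]
      refine Finset.sum_eq_zero fun s hs => he.mul_eq_zero_of_ne (hZΩ ω hω _ hr') (hSΩ hs) ?_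
      rintro rfl
      exact hnS hs
    rw [← hv2]
    exact DFunLike.congr_fun h0 v
  have hff : f * f = f := he.sum_idem hSΩ
  have hcard : Nat.card V ≤ Nat.card (AddMonoidHom.ker f) * Nat.card (AddMonoidHom.ker (1 - f)) := by
    rw [← Nat.card_prod]
    have hffv : ∀ v, f (f v) = f v := DFunLike.congr_fun hff
    refine Nat.card_le_card_of_injective (fun v : V => ((⟨v - f v, ?_⟩, ⟨f v, ?_⟩) :
      AddMonoidHom.ker f × AddMonoidHom.ker (1 - f))) ?_
    · change f (v - f v) = 0
      rw [map_sub, hffv, sub_self]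
    · change f v - f (f v) = 0
      rw [hffv, sub_self]
    · intro v w hvw
      simp only [Prod.mk.injEq, Subtype.mk.injEq] at hvw
      have := hvw.1
      rw [hvw.2] at this
      exact sub_left_injective this
  calc Nat.card V ≤ _ := hcard
    _ ≤ _ := Nat.mul_le_mul (card_le_index_of_inf_eq_bot hA) (card_le_index_of_inf_eq_bot hB)
    _ = _ := (sq _).symm

end Linear

/-! ### The fourth-power bound for irreducible soluble actions. -/

section Linear

variable {V : Type*} [AddCommGroup V] [Finite V] {H : Type*} [Group H] [DistribMulAction H V]

/-- Imprimitive case of `card_le_index_fixedAddSubgroup_pow_four`. -/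
theorem card_le_index_pow_four_of_isBlockIdempotent [Group.IsSolvable H]
    (hirr : ∀ U : AddSubgroup V, (∀ (h : H), ∀ u ∈ U, h • u ∈ U) → U = ⊥ ∨ U = ⊤)
    {x : H} (hx : normalClosure {x} = ⊤) {e₀ : AddMonoid.End V}
    (he₀ : IsBlockIdempotent (endConj V H) e₀) :
    Nat.card V ≤ (fixedAddSubgroup V x).index ^ 4 := by
  obtain ⟨e, he, hmax⟩ := he₀.exists_maximal
  set c := endConj V H with hc
  have hmul : ∀ g h : H, ∀ ω, c (g * h) ω = c g (c h ω) := fun g h ω => by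
    rw [map_mul, RingAut.mul_apply]
  have hinvT : ∀ (T : Subgroup H), T.Normal → ∀ t ∈ T,
      c t (∑ ω ∈ conjOrbit c T e, ω) = ∑ ω ∈ conjOrbit c T e, ω := by
    intro T hT t ht
    rw [map_sum_conjOrbit hT, conjOrbit_eq_of_mem (conj_mem_conjOrbit ht self_mem_conjOrbit)]
  have hsum : ∑ ω ∈ conjOrbit c ⊤ e, ω = 1 :=
    eq_one_of_forall_endConj_eq hirr (he.sum_idem subset_rfl) (he.sum_ne_zero ⊤)
      fun h => hinvT ⊤ inferInstance h (mem_top h)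
  set Ω := conjOrbit c ⊤ e with hΩ
  have hΩc : ∀ (h : H), ∀ ω ∈ Ω, c h ω ∈ Ω := fun h ω hω => conj_mem_conjOrbit (mem_top h) hω
  -- The kernel of the permutation action on the blocks.
  let K : Subgroup H :=
    { carrier := {h | ∀ ω ∈ Ω, c h ω = ω}
      one_mem' := fun ω _ => by simp
      mul_mem' := fun {a b} ha hb ω hω => by rw [hmul, hb ω hω, ha ω hω]
      inv_mem' := fun {a} ha ω hω => by
        conv_lhs => rw [← ha ω hω]
        rw [← hmul, inv_mul_cancel, map_one, RingAut.one_apply] }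
  have hKmem : ∀ {h}, h ∈ K ↔ ∀ ω ∈ Ω, c h ω = ω := Iff.rfl
  have hK : K.Normal := ⟨fun h hh g ω hω => by
    rw [hmul, hmul, hh _ (hΩc _ _ hω), ← hmul, mul_inv_cancel, map_one, RingAut.one_apply]⟩
  have hxK : x ∉ K := by
    intro h
    have hKtop : K = ⊤ := top_le_iff.1 (hx ▸ normalClosure_le_normal (by simpa using h))
    have h1 : Ω = {e} := by
      ext ω
      rw [Finset.mem_singleton]
      constructor
      · intro hω
        obtain ⟨t, -, rfl⟩ := (mem_conjOrbit c).1 hω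
        exact (hKtop ▸ mem_top t : t ∈ K) e self_mem_conjOrbit
      · rintro rfl
        exact self_mem_conjOrbit
    rw [h1, Finset.sum_singleton] at hsum
    exact he.ne_one hsum
  -- The last term of the derived series outside `K`: it acts on the blocks as an abelian group.
  obtain ⟨T, hT, hTK, hTT⟩ : ∃ T : Subgroup H, T.Normal ∧ ¬ T ≤ K ∧ ⁅T, T⁆ ≤ K := by
    classical
    have hex : ∃ n, derivedSeries H n ≤ K := by
      obtain ⟨n, hn⟩ := (Group.isSolvable_def H).1 inferInstance
      exact ⟨n, hn ▸ bot_le⟩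
    have h0 : Nat.find hex ≠ 0 := by
      intro h
      have := Nat.find_spec hex
      rw [h, derivedSeries_zero] at this
      exact hxK (this (mem_top x))
    refine ⟨derivedSeries H (Nat.find hex - 1), inferInstance,
      Nat.find_min hex (Nat.sub_one_lt h0), ?_⟩
    rw [← derivedSeries_succ, Nat.sub_one_add_one h0]
    exact Nat.find_spec hex
  -- Maximality of `e`: if the orbit sum is `1`, no block is left over; if it is `e`, then `T` fixes
  -- `e`, hence by normality every block, against `T ≰ K`.
  have htrans : ∀ ω ∈ Ω, ∃ t ∈ T, c t e = ω := by
    rcases hmax T hT with h1 | h1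
    · intro ω hω
      rw [← mem_conjOrbit]
      by_contra hn
      refine (fun h0 => he.ne_zero ?_ : ω ≠ 0) ?_
      · obtain ⟨t, -, rfl⟩ := (mem_conjOrbit c).1 hω
        exact (c t).map_eq_zero_iff.1 h0
      · rw [← one_mul ω, ← h1, Finset.sum_mul]
        refine Finset.sum_eq_zero fun a ha =>
          he.mul_eq_zero_of_ne (conjOrbit_mono le_top e ha) hω ?_
        rintro rfl
        exact hn ha
    · refine absurd (fun t ht => hKmem.2 fun ω hω => ?_) hTK
      obtain ⟨g, -, rfl⟩ := (mem_conjOrbit c).1 hω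
      have h2 : c (g⁻¹ * t * g) e = e := by
        conv_lhs => rw [← h1]
        rw [hinvT T hT _ (by simpa using hT.conj_mem t ht g⁻¹), h1]
      conv_rhs => rw [← h2]
      simp only [← hmul]
      congr 2
      group
  have htrans' : ∀ ω ∈ Ω, ∀ ω' ∈ Ω, ∃ t ∈ T, c t ω = ω' := by
    intro ω hω ω' hω'
    obtain ⟨s, hs, rfl⟩ := htrans ω hω
    obtain ⟨t, ht, rfl⟩ := htrans ω' hω'
    refine ⟨t * s⁻¹, T.mul_mem ht (T.inv_mem hs), ?_⟩
    rw [← hmul, inv_mul_cancel_right]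
  -- Commuting with the transitive `T` modulo `K`, such a `y` would fix all blocks if it fixed one.
  have hfpf : ∀ y, y ∉ K → (∀ t ∈ T, t * y * t⁻¹ * y⁻¹ ∈ K) →
      Nat.card V ≤ (fixedAddSubgroup V y).index ^ 2 := by
    intro y hy hyT
    refine card_le_index_sq_of_forall_endConj_ne he hsum fun ω hω hyω => hy fun ω' hω' => ?_
    obtain ⟨t, ht, rfl⟩ := htrans' ω hω ω' hω'
    have h1 := hyT t⁻¹ (T.inv_mem ht) _ hω
    have h2 : c (t⁻¹ * y * t) ω = ω := by
      have h3 : t⁻¹ * y * t = t⁻¹ * y * t⁻¹⁻¹ * y⁻¹ * y := by group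
      rw [h3, hmul, hyω, h1]
    conv_rhs => rw [← h2]
    rw [← hmul, ← hmul]
    congr 2
    group
  have hpos : 0 < (fixedAddSubgroup V x).index :=
    Nat.pos_of_ne_zero AddSubgroup.index_ne_zero_of_finite
  by_cases hcx : ∀ t ∈ T, t * x * t⁻¹ * x⁻¹ ∈ K
  · exact (hfpf x hxK hcx).trans (Nat.pow_le_pow_right hpos (by norm_num))
  · push Not at hcx
    obtain ⟨g, hg, hgK⟩ := hcx
    have hyT : g * x * g⁻¹ * x⁻¹ ∈ T := by
      have : g * x * g⁻¹ * x⁻¹ = g * (x * g⁻¹ * x⁻¹) := by group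
      rw [this]
      exact T.mul_mem hg (hT.conj_mem _ (T.inv_mem hg) x)
    refine (hfpf _ hgK fun t ht => hTT ?_).trans ?_
    · rw [← commutatorElement_def]
      exact commutator_mem_commutator ht hyT
    · calc _ ≤ ((fixedAddSubgroup V x).index ^ 2) ^ 2 :=
            Nat.pow_le_pow_left (index_fixedAddSubgroup_commutator_le g x) 2
        _ = _ := by rw [← pow_mul]

theorem exists_isIdempotentElem_pow {R : Type*} [Monoid R] [Finite R] (a : R) :
    ∃ n, 0 < n ∧ a ^ n * a ^ n = a ^ n := by
  obtain ⟨i, j, hij, h⟩ := Finite.exists_ne_map_eq_of_infinite (fun n : ℕ => a ^ n)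
  wlog hlt : i < j generalizing i j
  · exact this j i hij.symm h.symm (lt_of_le_of_ne (not_lt.1 hlt) hij.symm)
  have h1 : ∀ m, i ≤ m → a ^ (m + (j - i)) = a ^ m := by
    intro m hm
    obtain ⟨d, rfl⟩ := Nat.exists_eq_add_of_le hm
    have : i + d + (j - i) = j + d := by omega
    rw [this, pow_add, pow_add]
    exact congrArg (· * a ^ d) h.symm
  have h2 : ∀ t m, i ≤ m → a ^ (m + t * (j - i)) = a ^ m := by
    intro t
    induction t with
    | zero => intro m _; simp
    | succ t ih =>
      intro m hm
      rw [Nat.succ_mul, ← add_assoc, h1 _ (by omega), ih m hm]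
  have hpos : 1 ≤ j - i := by omega
  -- A multiple of the period `j - i` that is at least the preperiod `i`; the factor `i + 1` also
  -- keeps it positive.
  refine ⟨(i + 1) * (j - i), by positivity, ?_⟩
  rw [← pow_add, h2]
  nlinarith

/-- Under a faithful irreducible action without block idempotents, nontrivial elements of abelian
normal subgroups act without nonzero fixed points. -/
theorem fixedAddSubgroup_eq_bot [FaithfulSMul H V]
    (hirr : ∀ U : AddSubgroup V, (∀ (h : H), ∀ u ∈ U, h • u ∈ U) → U = ⊥ ∨ U = ⊤)
    (hno : ¬ ∃ e, IsBlockIdempotent (endConj V H) e) {A : Subgroup H} (hA : A.Normal)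
    (hcomm : ∀ a ∈ A, ∀ b ∈ A, a * b = b * a) {y : H} (hyA : y ∈ A) (hy : y ≠ 1) :
    fixedAddSubgroup V y = ⊥ := by
  by_contra hfix
  obtain ⟨u, huy, hu0⟩ := AddSubgroup.bot_or_exists_ne_zero (fixedAddSubgroup V y) |>.resolve_left hfix
  set ρ := DistribMulAction.toAddMonoidEnd H V with hρ
  set s : Set (AddMonoid.End V) := ρ '' A with hs
  set S := Subring.closure s with hS
  have hScomm : ∀ a ∈ S, ∀ b ∈ S, a * b = b * a := by
    have h1 : S ≤ Subring.centralizer s := by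
      refine Subring.closure_le.2 ?_
      rintro _ ⟨a, ha, rfl⟩
      refine Subring.mem_centralizer_iff.2 ?_
      rintro _ ⟨b, hb, rfl⟩
      rw [← map_mul, ← map_mul, hcomm a ha b hb]
    have h2 : S ≤ Subring.centralizer (S : Set (AddMonoid.End V)) := by
      refine Subring.closure_le.2 fun a ha => Subring.mem_centralizer_iff.2 fun b hb => ?_
      exact (Subring.mem_centralizer_iff.1 (h1 hb) a ha).symm
    exact fun a ha b hb => Subring.mem_centralizer_iff.1 (h2 hb) a ha
  have hSinv : ∀ (h : H), ∀ a ∈ S, endConj V H h a ∈ S := by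
    intro h
    have h1 : S ≤ S.comap (endConj V H h : AddMonoid.End V →+* AddMonoid.End V) := by
      refine Subring.closure_le.2 ?_
      rintro _ ⟨a, ha, rfl⟩
      refine Subring.subset_closure ⟨h * a * h⁻¹, hA.conj_mem a ha h, ?_⟩
      refine DFunLike.ext _ _ fun v => ?_
      change (h * a * h⁻¹) • v = h • a • h⁻¹ • v
      simp only [mul_smul]
    exact h1
  -- The common kernel of the nilpotent elements of `S` is invariant under `H`; once shown nonzero,
  -- it is all of `V` by irreducibility.
  have hnil : ∀ a ∈ S, IsNilpotent a → a = 0 := by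
    let J : Set (AddMonoid.End V) := {b | b ∈ S ∧ IsNilpotent b}
    have hW : ∃ v : V, v ≠ 0 ∧ ∀ b ∈ J, b v = 0 := by
      -- A nonzero vector killed by as many nilpotents as possible. If some `b` did not kill it, the
      -- last nonzero `b ^ m` applied to it would be killed by strictly more.
      obtain ⟨v, hv0, hv⟩ := Set.exists_max_image {v : V | v ≠ 0}
        (fun v => Set.ncard {b | b ∈ J ∧ b v = 0}) (Set.toFinite _) ⟨u, hu0⟩
      refine ⟨v, hv0, fun b hb => ?_⟩
      by_contra hbv
      classical
      have hex : ∃ n, (b ^ n) v = 0 := by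
        obtain ⟨n, hn⟩ := hb.2
        exact ⟨n, by rw [hn]; rfl⟩
      have h0 : Nat.find hex ≠ 0 := fun h => hv0 (by
        have := Nat.find_spec hex
        rw [h, pow_zero] at this
        exact this)
      obtain ⟨m, hm⟩ := Nat.exists_eq_succ_of_ne_zero h0
      have hm1 : (b ^ m) v ≠ 0 := Nat.find_min hex (by omega)
      have hm2 : b ((b ^ m) v) = 0 := by
        have := Nat.find_spec hex
        rw [hm, pow_succ'] at this
        exact this
      refine (hv _ hm1).not_gt (Set.ncard_lt_ncard ⟨fun d hd => ⟨hd.1, ?_⟩, fun h => ?_⟩)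
      · have h1 : d * b ^ m = b ^ m * d := hScomm _ hd.1.1 _ (pow_mem hb.1 m)
        have h2 := DFunLike.congr_fun h1 v
        change d ((b ^ m) v) = (b ^ m) (d v) at h2
        rw [h2, hd.2, map_zero]
      · exact hbv (h ⟨hb, hm2⟩).2
    obtain ⟨v, hv0, hv⟩ := hW
    let W : AddSubgroup V :=
      { carrier := {v | ∀ b ∈ J, b v = 0}
        zero_mem' := fun b _ => map_zero b
        add_mem' := fun {a b} ha hb d hd => by rw [map_add, ha d hd, hb d hd, add_zero]
        neg_mem' := fun {a} ha d hd => by rw [map_neg, ha d hd, neg_zero] }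
    have hWtop : W = ⊤ := by
      refine (hirr W fun h w hw b hb => ?_).resolve_left fun h => hv0 ?_
      · have h1 : endConj V H h⁻¹ b ∈ J := ⟨hSinv _ _ hb.1, hb.2.map _⟩
        have h2 : h⁻¹ • b (h⁻¹⁻¹ • w) = 0 := hw _ h1
        rw [inv_inv] at h2
        exact (smul_eq_zero_iff_eq _).1 h2
      · have : v ∈ W := hv
        rw [h] at this
        exact this
    intro a haS ha
    exact DFunLike.ext _ _ fun w => (hWtop ▸ AddSubgroup.mem_top w : w ∈ W) a ⟨haS, ha⟩
  have haS : ρ y - 1 ∈ S := sub_mem (Subring.subset_closure ⟨y, hyA, rfl⟩) (one_mem _)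
  -- This idempotent is not `0`, as `ρ y - 1` would be nilpotent and `y = 1`, and not `1`, as it
  -- kills `u`.
  obtain ⟨n, hn, hidem⟩ := exists_isIdempotentElem_pow (ρ y - 1)
  refine hno (exists_isBlockIdempotent hScomm hSinv (pow_mem haS n) (fun h0 => hy ?_)
    (fun h1 => hu0 ?_) hidem)
  · have h1 := hnil _ haS ⟨n, h0⟩
    refine FaithfulSMul.eq_of_smul_eq_smul (α := V) fun v => ?_
    rw [one_smul]
    exact DFunLike.congr_fun (sub_eq_zero.1 h1) v
  · obtain ⟨m, rfl⟩ := Nat.exists_eq_succ_of_ne_zero hn.ne'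
    rw [pow_succ] at h1
    have h2 := DFunLike.congr_fun h1 u
    change ((ρ y - 1) ^ m) (y • u - u) = u at h2
    rw [show y • u = u from huy, sub_self, map_zero] at h2
    exact h2.symm

/-- Without blocks, the aim is a nontrivial element of an abelian normal subgroup, obtained from `x`
by at most two commutators: it has no nonzero fixed vectors, and each commutator at most squares the
index. -/
theorem card_le_index_fixedAddSubgroup_pow_four_of_faithful [FaithfulSMul H V] [Finite H]
    [Group.IsSolvable H]
    (hirr : ∀ U : AddSubgroup V, (∀ (h : H), ∀ u ∈ U, h • u ∈ U) → U = ⊥ ∨ U = ⊤)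
    {x : H} (hx : normalClosure {x} = ⊤) (hx1 : x ≠ 1) :
    Nat.card V ≤ (fixedAddSubgroup V x).index ^ 4 := by
  by_cases hno : ∃ e, IsBlockIdempotent (endConj V H) e
  · obtain ⟨e, he⟩ := hno
    exact card_le_index_pow_four_of_isBlockIdempotent hirr hx he
  have hpos : 0 < (fixedAddSubgroup V x).index :=
    Nat.pos_of_ne_zero AddSubgroup.index_ne_zero_of_finite
  by_cases hab : ∀ a b : H, a * b = b * a
  · have := fixedAddSubgroup_eq_bot hirr hno (A := ⊤) inferInstance
      (fun a _ b _ => hab a b) (mem_top x) hx1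
    rw [this, AddSubgroup.index_bot]
    exact Nat.le_self_pow (by norm_num) _
  -- A minimal noncentral normal subgroup has central derived subgroup. It does not commute with
  -- `x`, since the conjugates of `x` generate `H`.
  obtain ⟨E, ⟨hEn, hEc⟩, hmin⟩ := Set.Finite.exists_minimal
    (s := {E : Subgroup H | E.Normal ∧ ¬ E ≤ center H}) (Set.toFinite _)
    ⟨⊤, inferInstance, fun h => hab fun a b => (mem_center_iff.1 (h (mem_top b)) a)⟩
  have hEE : ⁅E, E⁆ ≤ center H := by
    by_contra h
    have hlt : ⁅E, E⁆ < E := Group.IsSolvable.commutator_lt_of_ne_bot fun h => hEc (h ▸ bot_le)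
    exact hlt.not_ge (hmin ⟨inferInstance, h⟩ hlt.le)
  obtain ⟨g, hgE, hgx⟩ : ∃ g ∈ E, g * x ≠ x * g := by
    by_contra! h
    have h1 : x ∈ centralizer (E : Set H) := mem_centralizer_iff.2 h
    have h2 : centralizer (E : Set H) = ⊤ :=
      top_le_iff.1 (hx ▸ normalClosure_le_normal (by simpa using h1))
    refine hEc fun a ha => mem_center_iff.2 fun b => ?_
    have h3 : b ∈ centralizer (E : Set H) := h2 ▸ mem_top b
    exact (mem_centralizer_iff.1 h3 a ha).symm
  set y := g * x * g⁻¹ * x⁻¹ with hy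
  have hy1 : y ≠ 1 := fun h => hgx (by
    rw [hy, mul_inv_eq_one, mul_inv_eq_iff_eq_mul] at h
    exact h)
  have hyE : y ∈ E := by
    have : y = g * (x * g⁻¹ * x⁻¹) := by rw [hy]; group
    rw [this]
    exact E.mul_mem hgE (hEn.conj_mem _ (E.inv_mem hgE) x)
  have hidx : (fixedAddSubgroup V y).index ≤ (fixedAddSubgroup V x).index ^ 2 :=
    index_fixedAddSubgroup_commutator_le g x
  by_cases hyc : ∀ b ∈ E, b * y = y * b
  · have := fixedAddSubgroup_eq_bot hirr hno (A := E ⊓ centralizer (E : Set H)) inferInstance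
      (fun a ha b hb => mem_centralizer_iff.1 hb.2 a ha.1) ⟨hyE, mem_centralizer_iff.2 hyc⟩ hy1
    rw [this, AddSubgroup.index_bot] at hidx
    exact hidx.trans (Nat.pow_le_pow_right hpos (by norm_num))
  · push Not at hyc
    obtain ⟨b, hbE, hby⟩ := hyc
    have hz1 : b * y * b⁻¹ * y⁻¹ ≠ 1 := fun h => hby (by
      rw [mul_inv_eq_one, mul_inv_eq_iff_eq_mul] at h
      exact h)
    have hz : b * y * b⁻¹ * y⁻¹ ∈ center H := hEE (by
      rw [← commutatorElement_def]
      exact commutator_mem_commutator hbE hyE)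
    have := fixedAddSubgroup_eq_bot hirr hno (A := center H) inferInstance
      (fun a _ b hb => mem_center_iff.1 hb a) hz hz1
    have h2 := index_fixedAddSubgroup_commutator_le (V := V) b y
    rw [this, AddSubgroup.index_bot] at h2
    calc Nat.card V ≤ _ := h2
      _ ≤ ((fixedAddSubgroup V x).index ^ 2) ^ 2 := Nat.pow_le_pow_left hidx 2
      _ = _ := by rw [← pow_mul]

/-- If a finite soluble group generated by the conjugates of `x` acts irreducibly on a finite
abelian group `V`, with `x` acting nontrivially, then `|V| ≤ |V : C_V(x)| ^ 4`. -/
theorem card_le_index_fixedAddSubgroup_pow_four [Finite H] [Group.IsSolvable H]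
    (hirr : ∀ U : AddSubgroup V, (∀ (h : H), ∀ u ∈ U, h • u ∈ U) → U = ⊥ ∨ U = ⊤)
    {x : H} (hx : normalClosure {x} = ⊤) (hx1 : fixedAddSubgroup V x ≠ ⊤) :
    Nat.card V ≤ (fixedAddSubgroup V x).index ^ 4 := by
  let K := (DistribMulAction.toAddMonoidEnd H V).toHomUnits.range
  let φ : H →* K := (DistribMulAction.toAddMonoidEnd H V).toHomUnits.rangeRestrict
  have hφ : Function.Surjective φ := MonoidHom.rangeRestrict_surjective _
  have hsol : Group.IsSolvable K := Group.isSolvable_of_surjective hφ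
  have hfix : fixedAddSubgroup V (φ x) = fixedAddSubgroup V x := rfl
  have h1 : ∀ U : AddSubgroup V, (∀ (k : K), ∀ u ∈ U, k • u ∈ U) → U = ⊥ ∨ U = ⊤ :=
    fun U hU => hirr U fun h u hu => hU (φ h) u hu
  have h2 : normalClosure {φ x} = ⊤ := by
    have := map_normalClosure {x} φ hφ
    rw [hx, Set.image_singleton, map_top_of_surjective _ hφ] at this
    exact this.symm
  have h3 : φ x ≠ 1 := fun h => hx1 (top_le_iff.1 fun v _ => by
    rw [← hfix, mem_fixedAddSubgroup, h, one_smul])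
  rw [← hfix]
  exact card_le_index_fixedAddSubgroup_pow_four_of_faithful h1 h2 h3

end Linear

/-! ### Coprime action and a coset count. -/

/-- The norm `b ↦ ∏ φ s b` kills every generator `φ s b * b⁻¹`, while on a fixed element it is the
power `Nat.card S`, prime to the order of `A`. -/
theorem eq_one_of_mem_closure_of_forall_fixed {A S : Type*} [CommGroup A] [Finite A] [Group S]
    [Finite S] (φ : S →* MulAut A) (hc : (Nat.card S).Coprime (Nat.card A)) {a : A}
    (ha : a ∈ closure {x | ∃ s b, x = φ s b * b⁻¹}) (hfix : ∀ s, φ s a = a) : a = 1 := by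
  have := Fintype.ofFinite S
  let ν : A →* A := ∏ s : S, (φ s).toMonoidHom
  have hν : ∀ b, ν b = ∏ s : S, φ s b := fun b => by
    simp only [ν, MonoidHom.finsetProd_apply]
    rfl
  have h1 : closure {x | ∃ s b, x = φ s b * b⁻¹} ≤ ν.ker := by
    refine (closure_le _).2 ?_
    rintro _ ⟨t, b, rfl⟩
    change ν (φ t b * b⁻¹) = 1
    rw [map_mul, map_inv, mul_inv_eq_one, hν, hν]
    refine Fintype.prod_equiv (Equiv.mulRight t) _ _ fun s => ?_
    simp
  have h2 : a ^ Nat.card S = 1 := by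
    have h3 : ν a = 1 := h1 ha
    rw [hν, Finset.prod_congr rfl fun s _ => hfix s] at h3
    simpa using h3
  have h3 : orderOf a ∣ Nat.card S := orderOf_dvd_of_pow_eq_one h2
  have h4 : orderOf a ∣ Nat.card A := _root_.orderOf_dvd_natCard a
  exact orderOf_eq_one_iff.1 (Nat.eq_one_of_dvd_coprimes hc h3 h4)

theorem prod_index_le_card_of_forall_exists_sub_mem {ι A : Type*} [Fintype ι] [AddCommGroup A]
    [Finite A] (F : ι → AddSubgroup A) (h : ∀ v : ι → A, ∃ u, ∀ i, v i - u ∈ F i) :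
    ∏ i, (F i).index ≤ Nat.card A := by
  have h1 : ∏ i, (F i).index = Nat.card (∀ i, A ⧸ F i) := by
    rw [Nat.card_pi]
    rfl
  rw [h1]
  refine Nat.card_le_card_of_surjective (fun (u : A) (i : ι) => (u : A ⧸ F i)) fun w => ?_
  choose v hv using fun i => QuotientAddGroup.mk_surjective (w i)
  obtain ⟨u, hu⟩ := h v
  refine ⟨u, funext fun i => ?_⟩
  rw [← hv i, QuotientAddGroup.eq]
  rw [← sub_eq_neg_add]
  exact hu i

/-! ### Simultaneous conjugacy from Sylow's theorem. -/

section Conjugacy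

variable {G : Type*} [Group G] [Finite G]

theorem relIndex_sup_eq_card_of_isPGroup {p : ℕ} [Fact p.Prime] {S V : Subgroup G} [V.Normal]
    (hS : IsPGroup p S) (hV : ¬ p ∣ Nat.card V) : S.relIndex (S ⊔ V) = Nat.card V := by
  have hdisj : V ⊓ S = ⊥ := by
    have hc : (Nat.card V).Coprime (Nat.card S) := by
      obtain ⟨n, hn⟩ := hS.exists_card_eq
      rw [hn]
      exact (((Fact.out : p.Prime).coprime_iff_not_dvd.2 hV).pow_left n).symm
    exact (disjoint_of_coprime_natCard hc).eq_bot
  have h1 : V.relIndex S = Nat.card S := by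
    rw [← inf_relIndex_right, hdisj, relIndex_bot_left]
  have h2 : V.relIndex (S ⊔ V) = V.relIndex S := relIndex_sup_right _ _
  have h3 := relIndex_mul_relIndex ⊥ V (S ⊔ V) bot_le le_sup_right
  have h4 := relIndex_mul_relIndex ⊥ S (S ⊔ V) bot_le le_sup_left
  rw [relIndex_bot_left, relIndex_bot_left] at h3 h4
  rw [h2, h1, ← h4, mul_comm] at h3
  exact (Nat.eq_of_mul_eq_mul_left Nat.card_pos h3).symm

/-- Both are Sylow subgroups of `S ⊔ V`, so some `u * s` with `u ∈ V`, `s ∈ S` conjugates one to the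
other; the factor `s` normalizes `S` and can be dropped. -/
theorem exists_conj_eq_of_sup_eq {p : ℕ} [Fact p.Prime] {S S' V : Subgroup G} [V.Normal]
    (hS : IsPGroup p S) (hS' : IsPGroup p S') (hV : ¬ p ∣ Nat.card V) (h : S' ⊔ V = S ⊔ V) :
    ∃ u ∈ V, S' = S.map (MulAut.conj u).toMonoidHom := by
  set M := S ⊔ V with hM
  have h1 : ¬ p ∣ (S.subgroupOf M).index := by
    change ¬ p ∣ S.relIndex M
    rwa [relIndex_sup_eq_card_of_isPGroup hS hV]
  have h2 : ¬ p ∣ (S'.subgroupOf M).index := by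
    change ¬ p ∣ S'.relIndex M
    rwa [← h, relIndex_sup_eq_card_of_isPGroup hS' hV]
  have hSM : S ≤ M := le_sup_left
  have hSM' : S' ≤ M := h ▸ le_sup_left
  let P : Sylow p M := (hS.comap_subtype (K := M)).toSylow h1
  let P' : Sylow p M := (hS'.comap_subtype (K := M)).toSylow h2
  obtain ⟨m, hm⟩ := MulAction.exists_smul_eq M P P'
  obtain ⟨u, hu, s, hs, hus⟩ := mem_sup_of_normal_left.1 (sup_comm S V ▸ m.2 : (m : G) ∈ V ⊔ S)
  have hmem : ∀ y ∈ S, (m : G) * y * (m : G)⁻¹ ∈ S' := by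
    intro y hy
    have hyP : (⟨y, hSM hy⟩ : M) ∈ (P : Subgroup M) := hy
    have h3 : MulAut.conj m • (⟨y, hSM hy⟩ : M) ∈ MulAut.conj m • (P : Subgroup M) :=
      smul_mem_pointwise_smul _ _ _ hyP
    rw [← Sylow.coe_subgroup_smul, hm] at h3
    exact h3
  refine ⟨u, hu, (eq_of_le_of_card_ge ?_ ?_).symm⟩
  · rintro _ ⟨y, hy, rfl⟩
    have h4 := hmem (s⁻¹ * y * s) (S.mul_mem (S.mul_mem (S.inv_mem hs) hy) hs)
    rw [← hus] at h4
    have h5 : u * s * (s⁻¹ * y * s) * (u * s)⁻¹ = u * y * u⁻¹ := by group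
    rw [h5] at h4
    exact h4
  · have h6 : Nat.card (S.map (MulAut.conj u).toMonoidHom) = Nat.card S :=
      (Nat.card_congr (S.equivMapOfInjective _ (MulAut.conj u).injective).toEquiv).symm
    have h7 := relIndex_mul_relIndex ⊥ S M bot_le hSM
    have h8 := relIndex_mul_relIndex ⊥ S' M bot_le hSM'
    have h9 : S.relIndex M = Nat.card V := relIndex_sup_eq_card_of_isPGroup hS hV
    have h10 : S'.relIndex M = Nat.card V := by
      rw [← h, relIndex_sup_eq_card_of_isPGroup hS' hV]
    rw [relIndex_bot_left, relIndex_bot_left] at h7 h8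
    rw [h9, ← h8, h10] at h7
    rw [h6, Nat.eq_of_mul_eq_mul_right Nat.card_pos h7]

theorem not_dvd_card_of_forall_commute {p : ℕ} [Fact p.Prime] {S V : Subgroup G}
    (hS : IsPGroup p S) (hn : ∀ s ∈ S, ∀ v ∈ V, s * v * s⁻¹ ∈ V)
    (hfix : ∀ v ∈ V, (∀ s ∈ S, s * v = v * s) → v = 1) : ¬ p ∣ Nat.card V := by
  intro hd
  let _ : MulAction S V :=
    { smul := fun s v => ⟨s * v * (s : G)⁻¹, hn s s.2 v v.2⟩
      one_smul := fun v => Subtype.ext (by change (1 : G) * v * (1 : G)⁻¹ = v; simp)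
      mul_smul := fun s t v => Subtype.ext (by
        change (s * t : G) * v * (s * t : G)⁻¹ = s * (t * v * (t : G)⁻¹) * (s : G)⁻¹
        group) }
  have h1 : (1 : V) ∈ MulAction.fixedPoints S V := fun s => Subtype.ext (by
    change (s : G) * 1 * (s : G)⁻¹ = 1
    simp)
  obtain ⟨b, hb, hne⟩ := hS.exists_fixed_point_of_prime_dvd_card_of_fixed_point V hd h1
  refine hne (Subtype.ext (hfix b b.2 fun s hs => ?_).symm)
  have h2 : s * b * s⁻¹ = b := congrArg Subtype.val (hb ⟨s, hs⟩)
  exact mul_inv_eq_iff_eq_mul.1 h2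

/-- The two generated groups agree modulo `V`, so some `u ∈ V` conjugates the residual `S` to `S'`.
For each `i`, the elements `a = v i * c i * (v i)⁻¹` and `b = u * c i * u⁻¹` normalize `S'` and
agree modulo `V`. So `b⁻¹ * a ∈ V` normalizes `S'`, hence centralizes it because `S' ∩ V = 1`; by
`hfix` it is trivial. -/
theorem exists_forall_conj_eq_of_normal {ι : Type*} {p : ℕ} [Fact p.Prime] {w : List Nat.Primes}
    {V : Subgroup G} [V.Normal] {c v : ι → G} (hv : ∀ i, v i ∈ V)
    (hS : IsPGroup p (iteratedResidual w (closure (Set.range c))))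
    (hS' : IsPGroup p (iteratedResidual w (closure (Set.range fun i => v i * c i * (v i)⁻¹))))
    (hfix : ∀ u ∈ V, (∀ s ∈ iteratedResidual w (closure (Set.range c)), s * u = u * s) → u = 1) :
    ∃ u ∈ V, ∀ i, v i * c i * (v i)⁻¹ = u * c i * u⁻¹ := by
  set H := closure (Set.range c) with hH
  set H' := closure (Set.range fun i => v i * c i * (v i)⁻¹) with hH'
  set S := iteratedResidual w H with hSdef
  set S' := iteratedResidual w H' with hSdef'
  have hVn : V.Normal := inferInstance
  have hp : ¬ p ∣ Nat.card V :=
    not_dvd_card_of_forall_commute hS (fun s _ v hv => hVn.conj_mem v hv s) hfix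
  let q := QuotientGroup.mk' V
  have hq1 : ∀ x ∈ V, q x = 1 := fun x hx => (QuotientGroup.eq_one_iff x).2 hx
  have hqv : ∀ i, q (v i * c i * (v i)⁻¹) = q (c i) := fun i => by
    rw [map_mul, map_mul, map_inv, hq1 _ (hv i)]
    simp
  have hHH : H'.map q = H.map q := by
    rw [hH, hH', MonoidHom.map_closure, MonoidHom.map_closure, ← Set.range_comp, ← Set.range_comp]
    congr 2
    exact funext hqv
  have hSS : S' ⊔ V = S ⊔ V := by
    have h1 : S'.map q = S.map q := by
      rw [hSdef, hSdef', map_iteratedResidual, map_iteratedResidual, hHH]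
    rw [map_eq_map_iff, QuotientGroup.ker_mk'] at h1
    exact h1
  obtain ⟨u, hu, huS⟩ := exists_conj_eq_of_sup_eq hS hS' hp hSS
  have hdisj : ∀ a ∈ S', a ∈ V → a = 1 := by
    intro a ha haV
    obtain ⟨n, hn⟩ := hS'.exists_card_eq
    have h1 : orderOf a ∣ p ^ n := hn ▸ S'.orderOf_dvd_natCard ha
    have h2 : orderOf a ∣ Nat.card V := V.orderOf_dvd_natCard haV
    exact orderOf_eq_one_iff.1 (Nat.eq_one_of_dvd_coprimes
      (((Fact.out : p.Prime).coprime_iff_not_dvd.2 hp).pow_left n) h1 h2)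
  refine ⟨u, hu, fun i => ?_⟩
  set a := v i * c i * (v i)⁻¹ with ha
  set b := u * c i * u⁻¹ with hb
  have haS : ∀ s ∈ S', a * s * a⁻¹ ∈ S' := fun s hs =>
    conj_mem_iteratedResidual_of_mem w (subset_closure ⟨i, rfl⟩) hs
  have hbS : ∀ s ∈ S', b⁻¹ * s * b ∈ S' := by
    intro s hs
    rw [huS] at hs ⊢
    obtain ⟨t, ht, rfl⟩ := hs
    refine ⟨(c i)⁻¹ * t * (c i)⁻¹⁻¹, conj_mem_iteratedResidual_of_mem w
      (inv_mem (subset_closure ⟨i, rfl⟩)) ht, ?_⟩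
    change u * ((c i)⁻¹ * t * (c i)⁻¹⁻¹) * u⁻¹ = b⁻¹ * (u * t * u⁻¹) * b
    rw [hb]
    group
  have hdV : b⁻¹ * a ∈ V := by
    rw [← QuotientGroup.eq_one_iff]
    change q (b⁻¹ * a) = 1
    rw [map_mul, map_inv, hqv, hb, map_mul, map_mul, map_inv, hq1 u hu]
    simp
  set d := b⁻¹ * a with hd
  have hcomm : ∀ s ∈ S', d * s = s * d := by
    intro s hs
    have h1 : d * s * d⁻¹ ∈ S' := by
      have := hbS _ (haS s hs)
      have e : b⁻¹ * (a * s * a⁻¹) * b = d * s * d⁻¹ := by rw [hd]; group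
      rwa [e] at this
    have h2 : d * s * d⁻¹ * s⁻¹ ∈ V := by
      have e : d * s * d⁻¹ * s⁻¹ = d * (s * d⁻¹ * s⁻¹) := by group
      rw [e]
      exact V.mul_mem hdV (hVn.conj_mem _ (V.inv_mem hdV) s)
    have h3 := hdisj _ (S'.mul_mem h1 (S'.inv_mem hs)) h2
    rw [mul_inv_eq_one, mul_inv_eq_iff_eq_mul] at h3
    exact h3
  have h1 : u⁻¹ * d * u = 1 := by
    refine hfix _ ?_ fun s hs => ?_
    · simpa using hVn.conj_mem d hdV u⁻¹
    · have h2 : u * s * u⁻¹ ∈ S' := by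
        rw [huS]
        exact ⟨s, hs, rfl⟩
      have h3 := hcomm _ h2
      calc s * (u⁻¹ * d * u) = u⁻¹ * (u * s * u⁻¹ * d) * u := by group
        _ = u⁻¹ * (d * (u * s * u⁻¹)) * u := by rw [h3]
        _ = u⁻¹ * d * u * s := by group
  have h2 : d = 1 := by
    have : u⁻¹ * d * u⁻¹⁻¹ = 1 := by rwa [inv_inv]
    exact conj_eq_one_iff.1 this
  exact (inv_mul_eq_one.1 h2).symm

theorem exists_forall_conj_eq {ι : Type*} {p : ℕ} [Fact p.Prime] {w : List Nat.Primes}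
    {V : Subgroup G} {c v : ι → G} (hc : ∀ i, c i ∈ normalizer (V : Set G)) (hv : ∀ i, v i ∈ V)
    (hS : IsPGroup p (iteratedResidual w (closure (Set.range c))))
    (hS' : IsPGroup p (iteratedResidual w (closure (Set.range fun i => v i * c i * (v i)⁻¹))))
    (hfix : ∀ u ∈ V, (∀ s ∈ iteratedResidual w (closure (Set.range c)), s * u = u * s) → u = 1) :
    ∃ u ∈ V, ∀ i, v i * c i * (v i)⁻¹ = u * c i * u⁻¹ := by
  set N := normalizer (V : Set G) with hN
  have hVN : V ≤ N := le_normalizer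
  have hn : (V.subgroupOf N).Normal := normal_in_normalizer
  have key : ∀ d : ι → N, (iteratedResidual w (closure (Set.range d))).map N.subtype =
      iteratedResidual w (closure (Set.range fun i => (d i : G))) := by
    intro d
    rw [map_iteratedResidual, MonoidHom.map_closure, ← Set.range_comp]
    rfl
  have hP : ∀ d : ι → N, IsPGroup p (iteratedResidual w (closure (Set.range fun i => (d i : G)))) →
      IsPGroup p (iteratedResidual w (closure (Set.range d))) := by
    intro d hd
    rw [← key] at hd
    exact hd.of_injective
      ((iteratedResidual w (closure (Set.range d))).equivMapOfInjective _
        N.subtype_injective).toMonoidHom (MulEquiv.injective _)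
  obtain ⟨u, hu, h⟩ := exists_forall_conj_eq_of_normal (p := p) (w := w) (V := V.subgroupOf N)
    (c := fun i => ⟨c i, hc i⟩) (v := fun i => ⟨v i, hVN (hv i)⟩) hv (hP _ hS) (hP _ hS')
    (fun u hu hs => Subtype.ext (hfix u hu fun s hs' => by
      have h1 : s ∈ (iteratedResidual w (closure (Set.range fun i => (⟨c i, hc i⟩ : N)))).map
          N.subtype := by
        rw [key]
        exact hs'
      obtain ⟨t, ht, rfl⟩ := h1
      exact congrArg Subtype.val (hs t ht)))
  exact ⟨u, hu, fun i => congrArg Subtype.val (h i)⟩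

end Conjugacy

/-! ### Five generators and an irreducible module. -/

section Irreducible

variable {G : Type*} [Group G]

/-- The action of `H` by conjugation on an abelian subgroup it normalizes, written additively. -/
abbrev conjDistribMulAction {H V : Subgroup G} [IsMulCommutative V]
    (hHV : ∀ h ∈ H, ∀ v ∈ V, h * v * h⁻¹ ∈ V) : DistribMulAction H (Additive V) where
  smul h v := Additive.ofMul ⟨h * v.toMul * (h : G)⁻¹, hHV h h.2 _ v.toMul.2⟩
  one_smul v := by
    apply Additive.toMul.injective
    apply Subtype.ext
    change (1 : G) * v.toMul * (1 : G)⁻¹ = v.toMul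
    simp
  mul_smul s t v := by
    apply Additive.toMul.injective
    apply Subtype.ext
    change (s * t : G) * v.toMul * (s * t : G)⁻¹ = s * (t * v.toMul * (t : G)⁻¹) * (s : G)⁻¹
    group
  smul_zero h := by
    apply Additive.toMul.injective
    apply Subtype.ext
    change (h : G) * 1 * (h : G)⁻¹ = 1
    simp
  smul_add h u v := by
    apply Additive.toMul.injective
    apply Subtype.ext
    change (h : G) * (u.toMul * v.toMul) * (h : G)⁻¹ =
      h * u.toMul * (h : G)⁻¹ * (h * v.toMul * (h : G)⁻¹)
    group

/-- Otherwise every choice of `v` is equivalent to one simultaneous conjugation by some `u ∈ V`, so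
`V` maps onto the product of its five quotients by the `C_V(c i)`. These all have the index of
`C_V(x)`, and the fifth power of that index exceeds its fourth. -/
theorem exists_not_isPGroup_of_irreducible [Finite G] {p : ℕ} [Fact p.Prime] {w : List Nat.Primes}
    {H V : Subgroup G} [IsMulCommutative V] [Group.IsSolvable H]
    (hHV : ∀ h ∈ H, ∀ v ∈ V, h * v * h⁻¹ ∈ V)
    (hirr : ∀ U ≤ V, (∀ h ∈ H, ∀ u ∈ U, h * u * h⁻¹ ∈ U) → U = ⊥ ∨ U = V)
    {x : H} (hx : normalClosure {x} = ⊤) {c : Fin 5 → G}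
    (hc : ∀ i, ∃ h ∈ H, c i = h * x * h⁻¹) (hcl : closure (Set.range c) = H)
    (hS : IsPGroup p (iteratedResidual w H))
    (hSV : ∃ s ∈ iteratedResidual w H, ∃ v ∈ V, s * v ≠ v * s) :
    ∃ v : Fin 5 → G, (∀ i, v i ∈ V) ∧
      ¬ IsPGroup p (iteratedResidual w (closure (Set.range fun i => v i * c i * (v i)⁻¹))) := by
  by_contra! hno
  let _ : DistribMulAction H (Additive V) := conjDistribMulAction hHV
  have hcH : ∀ i, c i ∈ H := fun i => hcl ▸ subset_closure ⟨i, rfl⟩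
  -- The centralizer of the residual in `V` is invariant under `H` and proper by `hSV`, so it is
  -- trivial.
  have hfix : ∀ u ∈ V, (∀ s ∈ iteratedResidual w H, s * u = u * s) → u = 1 := by
    have h1 : V ⊓ centralizer (iteratedResidual w H : Set G) = ⊥ := by
      refine (hirr _ inf_le_left fun h hh u hu => ⟨hHV h hh u hu.1, ?_⟩).resolve_right fun h => ?_
      · refine mem_centralizer_iff.2 fun s hs => ?_
        have h2 := conj_mem_iteratedResidual_of_mem w (H.inv_mem hh) hs
        have h3 := mem_centralizer_iff.1 hu.2 _ h2
        calc s * (h * u * h⁻¹) = h * (h⁻¹ * s * h⁻¹⁻¹ * u) * h⁻¹ := by group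
          _ = h * (u * (h⁻¹ * s * h⁻¹⁻¹)) * h⁻¹ := by rw [h3]
          _ = h * u * h⁻¹ * s := by group
      · obtain ⟨s, hs, v, hv, hne⟩ := hSV
        have h2 : v ∈ V ⊓ centralizer (iteratedResidual w H : Set G) := by rwa [h]
        exact hne (mem_centralizer_iff.1 h2.2 s hs)
    intro u hu hs
    have h2 : u ∈ V ⊓ centralizer (iteratedResidual w H : Set G) :=
      ⟨hu, mem_centralizer_iff.2 hs⟩
    rw [h1] at h2
    exact h2
  have hfixmem : ∀ (h : H) (v : Additive V), v ∈ fixedAddSubgroup (Additive V) h ↔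
      (h : G) * v.toMul = v.toMul * h := by
    intro h v
    rw [mem_fixedAddSubgroup, ← Additive.toMul.injective.eq_iff, Subtype.ext_iff]
    exact mul_inv_eq_iff_eq_mul
  have hirr' : ∀ U : AddSubgroup (Additive V), (∀ (h : H), ∀ u ∈ U, h • u ∈ U) →
      U = ⊥ ∨ U = ⊤ := by
    intro U hU
    let U' : Subgroup V := AddSubgroup.toSubgroup' U
    rcases hirr (U'.map V.subtype) (map_subtype_le _) (by
      rintro h hh _ ⟨u, hu, rfl⟩
      exact ⟨_, hU ⟨h, hh⟩ (Additive.ofMul u) hu, rfl⟩) with h | h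
    · left
      have h1 : U' = ⊥ := (map_eq_bot_iff_of_injective _ V.subtype_injective).1 h
      exact AddSubgroup.toSubgroup'.injective (h1.trans (BotHomClass.map_bot _).symm)
    · right
      have h1 : U' = ⊤ := by
        apply map_injective V.subtype_injective
        rw [h, ← MonoidHom.range_eq_map, range_subtype]
      exact AddSubgroup.toSubgroup'.injective (h1.trans (TopHomClass.map_top _).symm)
  have hcx : ∀ i, ∃ h : H, (⟨c i, hcH i⟩ : H) = h * x * h⁻¹ := fun i => by
    obtain ⟨h, hh, he⟩ := hc i
    exact ⟨⟨h, hh⟩, Subtype.ext he⟩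
  have hidx : ∀ i, (fixedAddSubgroup (Additive V) (⟨c i, hcH i⟩ : H)).index =
      (fixedAddSubgroup (Additive V) x).index := fun i => by
    obtain ⟨h, he⟩ := hcx i
    rw [he, index_fixedAddSubgroup_conj]
  have hxtop : fixedAddSubgroup (Additive V) x ≠ ⊤ := by
    intro h
    have h1 : ∀ i, ∀ v ∈ V, v * c i = c i * v := by
      intro i v hv
      have h2 : fixedAddSubgroup (Additive V) (⟨c i, hcH i⟩ : H) = ⊤ := by
        rw [← AddSubgroup.index_eq_one, hidx, h, AddSubgroup.index_top]
      have h3 : Additive.ofMul (⟨v, hv⟩ : V) ∈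
          fixedAddSubgroup (Additive V) (⟨c i, hcH i⟩ : H) := h2 ▸ AddSubgroup.mem_top _
      exact ((hfixmem _ _).1 h3).symm
    have h2 : H ≤ centralizer (V : Set G) := by
      rw [← hcl, closure_le]
      rintro _ ⟨i, rfl⟩
      exact mem_centralizer_iff.2 (h1 i)
    obtain ⟨s, hs, v, hv, hne⟩ := hSV
    exact hne (mem_centralizer_iff.1 (h2 (iteratedResidual_le w H hs)) v hv).symm
  have hle := card_le_index_fixedAddSubgroup_pow_four hirr' hx hxtop
  have hge := prod_index_le_card_of_forall_exists_sub_mem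
    (fun i => fixedAddSubgroup (Additive V) (⟨c i, hcH i⟩ : H)) (by
      intro v
      have hcN : ∀ i, c i ∈ normalizer (V : Set G) := fun i =>
        (le_normalizer_iff (H := H) (K := V)).2 hHV (hcH i)
      obtain ⟨u, hu, hui⟩ := exists_forall_conj_eq (p := p) (w := w) hcN
        (v := fun i => ((v i).toMul : G)) (fun i => (v i).toMul.2) (by rwa [hcl])
        (hno _ fun i => (v i).toMul.2) (by rwa [hcl])
      refine ⟨Additive.ofMul ⟨u, hu⟩, fun i => (hfixmem _ _).2 ?_⟩
      have h1 := hui i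
      have hcm : ((Additive.toMul (v i) : V) : G) * u⁻¹ = u⁻¹ * (Additive.toMul (v i) : V) :=
        congrArg Subtype.val (mul_comm (Additive.toMul (v i)) (⟨u, hu⟩ : V)⁻¹)
      change c i * (Additive.toMul (v i - Additive.ofMul (⟨u, hu⟩ : V)) : V) =
        (Additive.toMul (v i - Additive.ofMul (⟨u, hu⟩ : V)) : V) * c i
      have h2 : ((Additive.toMul (v i - Additive.ofMul (⟨u, hu⟩ : V)) : V) : G) =
          u⁻¹ * (Additive.toMul (v i) : V) := by
        rw [toMul_sub, Subgroup.coe_div, div_eq_mul_inv]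
        exact hcm
      rw [h2]
      generalize ((Additive.toMul (v i) : V) : G) = a at h1
      calc c i * (u⁻¹ * a) = u⁻¹ * (u * c i * u⁻¹) * a := by group
        _ = u⁻¹ * (a * c i * a⁻¹) * a := by rw [h1]
        _ = u⁻¹ * a * c i := by group)
  simp only [hidx, Finset.prod_const, Finset.card_univ, Fintype.card_fin] at hge
  have hpos : 0 < (fixedAddSubgroup (Additive V) x).index :=
    Nat.pos_of_ne_zero AddSubgroup.index_ne_zero_of_finite
  have hne : (fixedAddSubgroup (Additive V) x).index ≠ 1 := fun h =>
    hxtop (AddSubgroup.index_eq_one.1 h)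
  have h5 := hge.trans hle
  exact absurd h5 (not_le.2 (Nat.pow_lt_pow_right (by omega) (by norm_num)))

end Irreducible

theorem exists_lift_iteratedResidual_not_le_ker {K L ι : Type*} [Group K] [Group L] [Finite K]
    (f : K →* L) (w : List Nat.Primes) {D : Set K} {c' : ι → L} (hc' : ∀ i, c' i ∈ f '' D)
    (h : iteratedResidual w (closure (Set.range c')) ≠ ⊥) :
    ∃ c : ι → K, (∀ i, c i ∈ D) ∧ ¬ iteratedResidual w (closure (Set.range c)) ≤ f.ker := by
  choose c hc hcc using hc'
  refine ⟨c, hc, fun hle => h ?_⟩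
  have h1 : closure (Set.range c') = (closure (Set.range c)).map f := by
    rw [MonoidHom.map_closure, ← Set.range_comp]
    congr 2
    exact (funext hcc).symm
  rw [h1, ← map_iteratedResidual]
  exact (Subgroup.map_eq_bot_iff _).2 hle

/-! ### The structure of a minimal counterexample. -/

section MinimalNormal

variable {K : Type u} [Group K]

/-- The central subgroup `N = pResidual r M` normalizes a Sylow `r`-subgroup `P` of `M` and has
`r`-power index, so `P` is normal in `M` and then in `K`. If nontrivial, `P` contains `N` by `hmin`,
so `N` is an `r`-group equal to its own residual, hence trivial. -/
theorem eq_bot_of_isPGroup_of_forall_commute [Finite K] {r : Nat.Primes} {M : Subgroup K} (hM : M.Normal)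
    (hne : pResidual r M ≠ ⊥)
    (hmin : ∀ N : Subgroup K, N.Normal → N ≠ ⊥ → pResidual r M ≤ N)
    (hcomm : ∀ m ∈ M, ∀ n ∈ pResidual r M, m * n = n * m)
    {R : Subgroup K} (hRM : R ≤ M) (hR : IsPGroup r R) : R = ⊥ := by
  have : Fact (r : ℕ).Prime := ⟨r.2⟩
  obtain ⟨P⟩ : Nonempty (Sylow r M) := inferInstance
  set N := pResidual r M with hN
  have hNn : (N.subgroupOf M).Normal :=
    ⟨fun x hx g => conj_mem_iteratedResidual_of_mem [r] g.2 hx⟩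
  have hidx : ∃ n, (N.subgroupOf M).index = (r : ℕ) ^ n := by
    have h2 : IsPGroup r ((⊤ : Subgroup M).map (QuotientGroup.mk' (N.subgroupOf M))) := by
      apply isPGroup_map_of_pResidual_le_ker
      rw [QuotientGroup.ker_mk', subgroupOf, ← map_le_iff_le_comap, map_pResidual,
        ← MonoidHom.range_eq_map, range_subtype]
    rw [map_top_of_surjective _ (QuotientGroup.mk'_surjective _)] at h2
    have h3 : IsPGroup r (M ⧸ N.subgroupOf M) := h2.of_equiv topEquiv
    exact h3.exists_card_eq
  have hNP : N.subgroupOf M ≤ normalizer (P : Set M) := by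
    refine (le_normalizer_iff (K := (P : Subgroup M))).2 fun n hn k hk => ?_
    have h1 : k * n = n * k := Subtype.ext (hcomm k k.2 n hn)
    rwa [← h1, mul_inv_cancel_right]
  have hnorm : normalizer (P : Set M) = ⊤ := by
    obtain ⟨n, hn⟩ := hidx
    have h1 : (normalizer (P : Set M)).index ∣ (r : ℕ) ^ n := hn ▸ index_dvd_of_le hNP
    have h2 : (normalizer (P : Set M)).index ∣ (P : Subgroup M).index :=
      index_dvd_of_le (le_normalizer (H := (P : Subgroup M)))
    have h3 : ((r : ℕ) ^ n).Coprime (P : Subgroup M).index :=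
      ((r.2.coprime_iff_not_dvd).2 P.not_dvd_index).pow_left n
    exact index_eq_one.1 (Nat.eq_one_of_dvd_coprimes h3 h1 h2)
  have hPn : (P : Subgroup M).Normal := normalizer_eq_top_iff.1 hnorm
  have hPc : (P : Subgroup M).Characteristic := P.characteristic_of_normal hPn
  have hPK : ((P : Subgroup M).map M.subtype).Normal := inferInstance
  have hPbot : (P : Subgroup M) = ⊥ := by
    by_contra hPb
    have h1 : N ≤ (P : Subgroup M).map M.subtype := hmin _ hPK fun h =>
      hPb ((map_eq_bot_iff_of_injective _ M.subtype_injective).1 h)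
    have h2 : IsPGroup r N := (P.isPGroup'.map M.subtype).to_le h1
    rw [← pResidual_eq_bot_iff, hN, pResidual_pResidual] at h2
    exact hne h2
  obtain ⟨Q, hQ⟩ := (hR.comap_subtype (K := M)).exists_le_sylow
  obtain ⟨g, hg⟩ := MulAction.exists_smul_eq M P Q
  rw [Sylow.smul_eq_of_normal] at hg
  rw [← hg, hPbot, le_bot_iff] at hQ
  refine (eq_bot_iff_forall _).2 fun x hx => ?_
  have h1 : (⟨x, hRM hx⟩ : M) ∈ comap M.subtype R := hx
  rw [hQ] at h1
  exact congrArg Subtype.val (mem_bot.1 h1)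

theorem isMulCommutative_of_forall_normal_le [Group.IsSolvable K] {N : Subgroup K} (hN : N.Normal)
    (hne : N ≠ ⊥) (hmin : ∀ N' : Subgroup K, N'.Normal → N' ≠ ⊥ → N ≤ N') :
    IsMulCommutative N := by
  have h1 : ⁅N, N⁆ = ⊥ := by
    by_contra h
    exact (Group.IsSolvable.commutator_lt_of_ne_bot hne).not_ge (hmin _ inferInstance h)
  have h2 := commutator_eq_bot_iff_le_centralizer.1 h1
  exact ⟨⟨fun a b => Subtype.ext (mem_centralizer_iff.1 (h2 b.2) a a.2)⟩⟩

/-- `M` acts on the abelian residual as an `r`-group. If `r` divided its order, there would be a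
nontrivial fixed point, and by `hmin` the whole residual would be centralized by `M`. -/
theorem not_dvd_card_of_isMulCommutative [Finite K] {r : Nat.Primes} {M : Subgroup K} (hM : M.Normal)
    [IsMulCommutative (pResidual r M)]
    (hmin : ∀ N : Subgroup K, N.Normal → N ≠ ⊥ → pResidual r M ≤ N)
    (hcomm : ¬ M ≤ centralizer (pResidual r M : Set K)) : ¬ (r : ℕ) ∣ Nat.card (pResidual r M) := by
  intro hd
  have : Fact (r : ℕ).Prime := ⟨r.2⟩
  set N := pResidual r M with hN
  have hNn : N.Normal := normal_iteratedResidual [r] hM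
  let φ : K →* MulAut N := MulAut.conjNormal
  have hA : IsPGroup r (M.map φ) := by
    apply isPGroup_map_of_pResidual_le_ker
    intro n hn
    refine MulEquiv.ext fun b => Subtype.ext ?_
    change n * b * n⁻¹ = b
    rw [mul_inv_eq_iff_eq_mul]
    exact congrArg Subtype.val (mul_comm (⟨n, hn⟩ : N) b)
  obtain ⟨b, hb, hne⟩ := hA.exists_fixed_point_of_prime_dvd_card_of_fixed_point N hd (a := 1)
    fun g => smul_one g
  have hZ : N ≤ N ⊓ centralizer (M : Set K) := by
    refine hmin _ inferInstance fun h => hne ?_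
    have h1 : (b : K) ∈ N ⊓ centralizer (M : Set K) := by
      refine ⟨b.2, mem_centralizer_iff.2 fun m hm => ?_⟩
      have h2 : m * b * m⁻¹ = b := congrArg Subtype.val (hb ⟨φ m, m, hm, rfl⟩)
      exact mul_inv_eq_iff_eq_mul.1 h2
    rw [h] at h1
    exact (Subtype.ext (mem_bot.1 h1)).symm
  refine hcomm fun m hm => mem_centralizer_iff.2 fun n hn => ?_
  exact (mem_centralizer_iff.1 (hZ hn).2 m hm).symm

/-- A minimal subgroup generated by members of `D` among those whose iterated residual is not
contained in `C` is generated by five conjugates of a single member of `D`. -/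
theorem exists_subgroup_generated_by_five [Finite K] {w : List Nat.Primes}
    (ih : ∀ {L : Type u} [Group L] [Finite L] [Group.IsSolvable L] (D : Set L),
      (∀ g, ∀ d ∈ D, g * d * g⁻¹ ∈ D) → closure D = ⊤ → iteratedResidual w (⊤ : Subgroup L) ≠ ⊥ →
      ∃ c : Fin 5 → L, (∀ i, c i ∈ D) ∧ iteratedResidual w (closure (Set.range c)) ≠ ⊥)
    [Group.IsSolvable K] {D : Set K} (hD : ∀ g, ∀ d ∈ D, g * d * g⁻¹ ∈ D) (hgen : closure D = ⊤)
    {C : Subgroup K} [C.Normal] (hC : ¬ iteratedResidual w ⊤ ≤ C) :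
    ∃ (H : Subgroup K) (x : H) (c : Fin 5 → K), normalClosure {x} = ⊤ ∧ (∀ i, c i ∈ D) ∧
      (∀ i, ∃ h ∈ H, c i = h * x * h⁻¹) ∧ closure (Set.range c) = H ∧
      ¬ iteratedResidual w H ≤ C := by
  obtain ⟨H, ⟨hHD, hHC⟩, hmin⟩ := Set.Finite.exists_minimal
    (s := {J : Subgroup K | J ≤ closure (D ∩ J) ∧ ¬ iteratedResidual w J ≤ C}) (Set.toFinite _)
    ⟨⊤, by simp [hgen], hC⟩
  have hsub : ∀ A : Subgroup H, ∀ s : Set H, closure s = A → (∀ y ∈ s, (y : K) ∈ D) →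
      ¬ iteratedResidual w A ≤ C.comap H.subtype → A = ⊤ := by
    intro A s hs hsD hA
    have h1 : A.map H.subtype ∈ {J : Subgroup K | J ≤ closure (D ∩ J) ∧
        ¬ iteratedResidual w J ≤ C} := by
      constructor
      · nth_rewrite 1 [← hs]
        rw [MonoidHom.map_closure, closure_le]
        rintro _ ⟨y, hy, rfl⟩
        exact subset_closure ⟨hsD y hy, y, hs ▸ subset_closure hy, rfl⟩
      · rwa [← map_iteratedResidual, map_le_iff_le_comap]
    have h2 := hmin h1 (map_subtype_le A)
    apply map_injective H.subtype_injective
    rw [← MonoidHom.range_eq_map, range_subtype]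
    exact le_antisymm (map_subtype_le A) h2
  have hconj : ∀ x : H, (x : K) ∈ D → ∀ y ∈ Group.conjugatesOfSet {x}, ∃ h : H, y = h * x * h⁻¹ := by
    intro x _ y hy
    obtain ⟨a, ha, hc⟩ := Group.mem_conjugatesOfSet_iff.1 hy
    rw [Set.mem_singleton_iff.1 ha] at hc
    obtain ⟨g, hg⟩ := isConj_iff.1 hc
    exact ⟨g, hg.symm⟩
  have hconjD : ∀ x : H, (x : K) ∈ D → ∀ y ∈ Group.conjugatesOfSet {x}, (y : K) ∈ D := by
    intro x hx y hy
    obtain ⟨h, rfl⟩ := hconj x hx y hy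
    exact hD h x hx
  have htop : ¬ iteratedResidual w (⊤ : Subgroup H) ≤ C.comap H.subtype := by
    rwa [← map_le_iff_le_comap, map_iteratedResidual, ← MonoidHom.range_eq_map, range_subtype]
  -- `H` is the join of the normal closures of members of `D`; the residual of a join of normal
  -- subgroups lies in the join of the residuals, so one of these escapes `C`.
  obtain ⟨x, hxD, hx⟩ : ∃ x : H, (x : K) ∈ D ∧
      ¬ iteratedResidual w (normalClosure {x}) ≤ C.comap H.subtype := by
    by_contra! hall
    have hsup : (⊤ : Subgroup H) ≤ ⨆ y : {y : H // (y : K) ∈ D}, normalClosure {y.1} := by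
      have h1 : H ≤ (⨆ y : {y : H // (y : K) ∈ D}, normalClosure {y.1}).map H.subtype := by
        refine hHD.trans ((closure_le _).2 ?_)
        rintro y ⟨hyD, hyH⟩
        refine ⟨⟨y, hyH⟩, ?_, rfl⟩
        exact le_iSup (fun y : {y : H // (y : K) ∈ D} => normalClosure {y.1}) ⟨⟨y, hyH⟩, hyD⟩
          (subset_normalClosure rfl)
      intro y _
      obtain ⟨z, hz, hzy⟩ := h1 y.2
      rwa [← show z = y from Subtype.ext hzy]
    refine htop ((iteratedResidual_mono w hsup).trans
      ((iteratedResidual_iSup_le w _ fun _ => normalClosure_normal).trans ?_))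
    exact iSup_le fun y => hall y.1 y.2
  have hxtop : normalClosure {x} = ⊤ := hsub _ _ rfl (hconjD x hxD) hx
  -- Modulo `C`, the hypothesis for `w` supplies five conjugates of `x`; lifted, they generate `H`
  -- by minimality.
  let q := QuotientGroup.mk' (C.subgroupOf H)
  have hker : q.ker = C.comap H.subtype := QuotientGroup.ker_mk' _
  have hqs : Function.Surjective q := QuotientGroup.mk'_surjective _
  obtain ⟨c', hc'D, hc'⟩ := ih (q '' Group.conjugatesOfSet {x}) (by
    intro g
    obtain ⟨h, rfl⟩ := hqs g
    rintro _ ⟨y, hy, rfl⟩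
    exact ⟨h * y * h⁻¹, Group.conj_mem_conjugatesOfSet hy, by simp⟩) (by
    rw [← MonoidHom.map_closure]
    change (normalClosure {x}).map q = ⊤
    rw [hxtop, map_top_of_surjective _ hqs]) (by
    rw [← map_top_of_surjective q hqs, ← map_iteratedResidual, Ne, Subgroup.map_eq_bot_iff, hker]
    exact htop)
  obtain ⟨c, hcD, hc⟩ := exists_lift_iteratedResidual_not_le_ker q w hc'D hc'
  rw [hker] at hc
  have hctop : closure (Set.range c) = ⊤ := by
    refine hsub _ _ rfl ?_ hc
    rintro _ ⟨i, rfl⟩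
    exact hconjD x hxD _ (hcD i)
  refine ⟨H, x, fun i => c i, hxtop, fun i => hconjD x hxD _ (hcD i), fun i => ?_, ?_, hHC⟩
  · obtain ⟨h, hh⟩ := hconj x hxD _ (hcD i)
    exact ⟨h, h.2, congrArg Subtype.val hh⟩
  · have h1 := congrArg (map H.subtype) hctop
    rw [MonoidHom.map_closure, ← Set.range_comp, ← MonoidHom.range_eq_map, range_subtype] at h1
    exact h1

/-- `V` is a minimal nontrivial `H`-invariant subgroup of `W = [N, S]`; by coprimeness, no
nontrivial element of `W` is fixed by `S`. -/
theorem exists_irreducible_le [Finite K] {r : ℕ} [Fact r.Prime] {N S H : Subgroup K} [N.Normal]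
    [IsMulCommutative N] (hSn : ∀ h ∈ H, ∀ s ∈ S, h * s * h⁻¹ ∈ S)
    (hS : IsPGroup r S) (hr : ¬ r ∣ Nat.card N) (hSN : ¬ S ≤ centralizer (N : Set K)) :
    ∃ V ≤ N, (∀ h ∈ H, ∀ v ∈ V, h * v * h⁻¹ ∈ V) ∧
      (∀ U ≤ V, (∀ h ∈ H, ∀ u ∈ U, h * u * h⁻¹ ∈ U) → U = ⊥ ∨ U = V) ∧
      ∃ s ∈ S, ∃ v ∈ V, s * v ≠ v * s := by
  have hN : N.Normal := inferInstance
  let φ : S →* MulAut N := MulAut.conjNormal.comp S.subtype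
  have hφ : ∀ (s : S) (b : N), ((φ s b : N) : K) = s * b * (s : K)⁻¹ := fun s b => rfl
  set W' : Subgroup N := closure {x | ∃ s b, x = φ s b * b⁻¹} with hW'
  set W := W'.map N.subtype with hW
  have hWinv : ∀ h ∈ H, ∀ v ∈ W, h * v * h⁻¹ ∈ W := by
    intro h hh
    have h1 : W.map (MulAut.conj h).toMonoidHom ≤ W := by
      rw [hW, hW', MonoidHom.map_closure, MonoidHom.map_closure, closure_le]
      rintro _ ⟨_, ⟨_, ⟨s, b, rfl⟩, rfl⟩, rfl⟩
      refine subset_closure ⟨_, ⟨⟨h * s * h⁻¹, hSn h hh s s.2⟩,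
        ⟨h * b * h⁻¹, hN.conj_mem b b.2 h⟩, rfl⟩, ?_⟩
      change h * s * h⁻¹ * (h * b * h⁻¹) * (h * s * h⁻¹)⁻¹ * (h * b * h⁻¹)⁻¹ =
        h * (s * b * (s : K)⁻¹ * (b : K)⁻¹) * h⁻¹
      group
    exact fun v hv => h1 ⟨v, hv, rfl⟩
  have hWne : W ≠ ⊥ := by
    intro hbot
    refine hSN fun s hs => mem_centralizer_iff.2 fun n hn => ?_
    have h1 : s * n * s⁻¹ * n⁻¹ ∈ W :=
      ⟨_, subset_closure ⟨⟨s, hs⟩, ⟨n, hn⟩, rfl⟩, rfl⟩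
    rw [hbot, mem_bot, mul_inv_eq_one, mul_inv_eq_iff_eq_mul] at h1
    exact h1.symm
  obtain ⟨V, ⟨hVW, hVne, hVinv⟩, hmin⟩ := Set.Finite.exists_minimal
    (s := {U : Subgroup K | U ≤ W ∧ U ≠ ⊥ ∧ ∀ h ∈ H, ∀ v ∈ U, h * v * h⁻¹ ∈ U}) (Set.toFinite _)
    ⟨W, le_rfl, hWne, hWinv⟩
  refine ⟨V, hVW.trans (map_subtype_le _), hVinv, fun U hUV hU => ?_, ?_⟩
  · refine or_iff_not_imp_left.2 fun hne => le_antisymm hUV ?_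
    exact hmin ⟨hUV.trans hVW, hne, hU⟩ hUV
  · by_contra! hall
    refine hVne ((eq_bot_iff_forall _).2 fun v hv => ?_)
    obtain ⟨a, ha, rfl⟩ := hVW hv
    have hc : (Nat.card S).Coprime (Nat.card N) := by
      obtain ⟨n, hn⟩ := hS.exists_card_eq
      rw [hn]
      exact ((Fact.out : r.Prime).coprime_iff_not_dvd.2 hr).pow_left n
    have h1 := eq_one_of_mem_closure_of_forall_fixed φ hc ha fun s => Subtype.ext (by
      rw [hφ, mul_inv_eq_iff_eq_mul]
      exact hall s s.2 a hv)
    rw [h1]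
    rfl

end MinimalNormal

/-! ### Five members suffice for a nontrivial residual. -/

/-- If `D` is a normal subset generating a finite soluble group whose iterated residual is
nontrivial, then some five members of `D` generate a subgroup with the same property. -/
theorem exists_five_iteratedResidual_ne_bot (w : List Nat.Primes) :
    ∀ {K : Type u} [Group K] [Finite K] [Group.IsSolvable K] (D : Set K),
      (∀ g, ∀ d ∈ D, g * d * g⁻¹ ∈ D) → closure D = ⊤ → iteratedResidual w (⊤ : Subgroup K) ≠ ⊥ →
      ∃ c : Fin 5 → K, (∀ i, c i ∈ D) ∧ iteratedResidual w (closure (Set.range c)) ≠ ⊥ := by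
  induction w with
  | nil =>
    intro K _ _ _ D _ hgen hne
    obtain ⟨d, hd, hd1⟩ : ∃ d ∈ D, d ≠ 1 := by
      by_contra! h
      exact hne (hgen.symm.trans (closure_eq_bot_iff.2 h))
    refine ⟨fun _ => d, fun _ => hd, fun h => hd1 ?_⟩
    have h1 : d ∈ closure (Set.range fun _ : Fin 5 => d) := subset_closure ⟨0, rfl⟩
    rw [show closure (Set.range fun _ : Fin 5 => d) = ⊥ from h] at h1
    exact mem_bot.1 h1
  | cons r w ih =>
    suffices ∀ n : ℕ, ∀ {K : Type u} [Group K] [Finite K] [Group.IsSolvable K] (D : Set K),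
        Nat.card K = n → (∀ g, ∀ d ∈ D, g * d * g⁻¹ ∈ D) → closure D = ⊤ →
        iteratedResidual (r :: w) (⊤ : Subgroup K) ≠ ⊥ →
        ∃ c : Fin 5 → K, (∀ i, c i ∈ D) ∧
          iteratedResidual (r :: w) (closure (Set.range c)) ≠ ⊥ from
      fun {K} _ _ _ D => this _ D rfl
    intro n
    induction n using Nat.strong_induction_on with
    | _ n ihn =>
    intro K _ _ _ D hcard hD hgen hne
    have hr : Fact (r : ℕ).Prime := ⟨r.2⟩
    by_contra! hno
    have hnoP : ∀ c : Fin 5 → K, (∀ i, c i ∈ D) →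
        IsPGroup r (iteratedResidual w (closure (Set.range c))) := fun c hc =>
      (pResidual_eq_bot_iff r _).1 (hno c hc)
    -- A proper quotient with nontrivial residual would supply five members that lift to `K`.
    have hmin : ∀ N : Subgroup K, N.Normal → N ≠ ⊥ →
        pResidual r (iteratedResidual w (⊤ : Subgroup K)) ≤ N := by
      intro N hN hNb
      by_contra hle
      have hqs := QuotientGroup.mk'_surjective N
      obtain ⟨c', hc'D, hc'⟩ := ihn (Nat.card (K ⧸ N)) (by
          rw [← hcard, card_eq_card_quotient_mul_card_subgroup N]
          exact lt_mul_of_one_lt_right Nat.card_pos (one_lt_card_iff_ne_bot N |>.2 hNb))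
        (QuotientGroup.mk' N '' D) rfl (by
          intro g
          obtain ⟨h, rfl⟩ := hqs g
          rintro _ ⟨y, hy, rfl⟩
          exact ⟨h * y * h⁻¹, hD h y hy, by simp⟩) (by
          rw [← MonoidHom.map_closure, hgen, map_top_of_surjective _ hqs]) (by
          rw [← map_top_of_surjective _ hqs, ← map_iteratedResidual, Ne, Subgroup.map_eq_bot_iff,
            QuotientGroup.ker_mk']
          exact hle)
      obtain ⟨c, hcD, hc⟩ :=
        exists_lift_iteratedResidual_not_le_ker (QuotientGroup.mk' N) (r :: w) hc'D hc'
      exact hc (hno c hcD ▸ bot_le)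
    have hM : (iteratedResidual w (⊤ : Subgroup K)).Normal :=
      normal_iteratedResidual w inferInstance
    have hneM : iteratedResidual w (⊤ : Subgroup K) ≠ ⊥ := fun h =>
      hne (le_bot_iff.1 (h ▸ pResidual_le r _))
    set M := iteratedResidual w (⊤ : Subgroup K) with hMdef
    set N := pResidual r M with hNdef
    -- In the centralizing case the hypothesis for the shorter word gives five members with
    -- nontrivial residual, an `r`-subgroup of `M`; but `M` then has no such subgroup.
    by_cases hcomm : M ≤ centralizer (N : Set K)
    · obtain ⟨c, hcD, hc⟩ := ih D hD hgen hneM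
      refine hc (eq_bot_of_isPGroup_of_forall_commute (r := r) hM hne hmin (fun m hm n hn => ?_)
        (iteratedResidual_mono w le_top) (hnoP c hcD))
      exact (mem_centralizer_iff.1 (hcomm hm) n hn).symm
    have hN : N.Normal := normal_iteratedResidual [r] hM
    have hNc : IsMulCommutative N := isMulCommutative_of_forall_normal_le hN hne hmin
    have hrN : ¬ (r : ℕ) ∣ Nat.card N := not_dvd_card_of_isMulCommutative hM hmin hcomm
    obtain ⟨H, x, c, hx, hcD, hcx, hcl, hHC⟩ :=
      exists_subgroup_generated_by_five ih hD hgen hcomm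
    have hS : IsPGroup r (iteratedResidual w H) := hcl ▸ hnoP c hcD
    obtain ⟨V, hVN, hVinv, hirr, hSV⟩ := exists_irreducible_le (r := r) (N := N) (H := H)
      (fun h hh s hs => conj_mem_iteratedResidual_of_mem w hh hs) hS hrN hHC
    have hVc : IsMulCommutative V :=
      ⟨⟨fun a b => Subtype.ext (show (a : K) * b = b * a from congrArg (fun z : N => (z : K))
        (mul_comm (⟨a, hVN a.2⟩ : N) ⟨b, hVN b.2⟩))⟩⟩
    obtain ⟨v, hv, hnot⟩ := exists_not_isPGroup_of_irreducible hVinv hirr hx hcx hcl hS hSV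
    exact hnot (hnoP _ fun i => hD _ _ (hcD i))

/-! ### Central residuals and the choice of the word. -/

namespace Subgroup

variable {G : Type*} [Group G] [Finite G] {r : Nat.Primes} {w : List Nat.Primes}

/-- Transfer into the centre is the homomorphism `x ↦ x ^ n`, `n` being the index of the centre. It
sends the `r`-residual to elements of order prime to `r`. As the residual along `w` is central of
index prime to `r`, so is `n`, and an `r`-element `x` with `x ^ n` of order prime to `r` is trivial.
-/
theorem iteratedResidual_inf_pResidual_eq_bot (hr : r ∉ w) {M : Subgroup G}
    (hP : IsPGroup r (iteratedResidual w M))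
    (hc : ∀ x ∈ iteratedResidual w M, ∀ h ∈ M, h * x = x * h) :
    iteratedResidual w M ⊓ pResidual r M = ⊥ := by
  have : Fact (r : ℕ).Prime := ⟨r.2⟩
  set n := (center M).index
  have hn : ¬ (r : ℕ) ∣ n := fun h => not_dvd_index_iteratedResidual hr <| h.trans <|
    index_dvd_of_le (H := (iteratedResidual w M).subgroupOf M) fun x hx =>
      mem_center_iff.2 fun g => Subtype.ext (hc x hx g g.2)
  have hcop : (r : ℕ).Coprime n := (Nat.Prime.coprime_iff_not_dvd r.2).2 hn
  have hpow : ∀ x ∈ pResidual r M, (orderOf (x ^ n)).Coprime r := by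
    intro x hx
    induction hx using closure_induction with
    | mem x hx => exact hx.2.coprime_dvd_left (orderOf_pow_dvd n)
    | one => simp
    | inv x _ ih => rwa [inv_pow, orderOf_inv]
    | mul x y hx hy ihx ihy =>
      have key := congrArg (fun t : center M => ((t : M) : G))
        ((MonoidHom.transferCenterPow M).map_mul ⟨x, pResidual_le _ _ hx⟩ ⟨y, pResidual_le _ _ hy⟩)
      have hmem := mem_center_iff.1
        (MonoidHom.transferCenterPow M ⟨y, pResidual_le _ _ hy⟩).2 (⟨x, pResidual_le _ _ hx⟩ ^ n)
      rw [MonoidHom.transferCenterPow_apply] at hmem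
      have hcomm : Commute (x ^ n) (y ^ n) := congrArg Subtype.val hmem
      simp only [coe_mul, MonoidHom.transferCenterPow_apply, coe_pow] at key
      rw [key]
      exact (Nat.Coprime.mul_left ihx ihy).coprime_dvd_left hcomm.orderOf_mul_dvd_mul_orderOf
  refine (eq_bot_iff_forall _).2 fun x hx => ?_
  obtain ⟨k, hk⟩ := hP ⟨x, hx.1⟩
  have hk' : x ^ (r : ℕ) ^ k = 1 := congrArg Subtype.val hk
  obtain ⟨m, -, hm⟩ := (Nat.dvd_prime_pow r.2).1 (orderOf_dvd_of_pow_eq_one hk')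
  have h1 := hpow x hx.2
  have h2 : (orderOf x).Coprime n := hm ▸ hcop.pow_left m
  rw [Nat.Coprime.orderOf_pow h2] at h1
  have h3 := hm ▸ h1.pow_right m
  exact orderOf_eq_one_iff.1 (by simpa [hm] using h3)

/-- Split `w` at the leftmost `r`, the last one to act: the group just after that step is its own
`r`-residual, and the letters still to act are not `r`. -/
theorem iteratedResidual_eq_bot_of_mem (hr : r ∈ w) {M : Subgroup G}
    (hP : IsPGroup r (iteratedResidual w M))
    (hc : ∀ x ∈ iteratedResidual w M, ∀ h ∈ M, h * x = x * h) :
    iteratedResidual w M = ⊥ := by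
  obtain ⟨w₂, w₁, rfl, hw⟩ := List.eq_append_cons_of_mem hr
  rw [iteratedResidual_append] at hP hc ⊢
  have key := iteratedResidual_inf_pResidual_eq_bot hw hP
    fun x hx h hh => hc x hx h (iteratedResidual_le _ _ hh)
  have h1 : pResidual r (iteratedResidual (r :: w₁) M) = iteratedResidual (r :: w₁) M :=
    pResidual_pResidual _ _
  rwa [h1, inf_eq_left.2 (iteratedResidual_le _ _)] at key

/-- Minimize the sum of the orders of the residuals over words not killing every `A i`. Some `r`
shrinks a surviving residual, so by minimality `r :: w` kills them all. -/
theorem exists_isPGroup_iteratedResidual {ι : Type*} [Finite ι] (A : ι → Subgroup G)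
    (hA : ∀ i, Group.IsSolvable (A i)) (h : ∃ i, A i ≠ ⊥) :
    ∃ (r : Nat.Primes) (w : List Nat.Primes), (∃ i, iteratedResidual w (A i) ≠ ⊥) ∧
      ∀ i, IsPGroup r (iteratedResidual w (A i)) := by
  have := Fintype.ofFinite ι
  obtain ⟨w, ⟨i, hi⟩, hmin⟩ := (measure fun w => ∑ i, Nat.card (iteratedResidual w (A i))).wf.has_min
    {w | ∃ i, iteratedResidual w (A i) ≠ ⊥} ⟨[], h⟩
  have := hA i
  have : Group.IsSolvable (iteratedResidual w (A i)) :=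
    Group.isSolvable_of_isSolvable_injective (inclusion_injective (iteratedResidual_le w (A i)))
  obtain ⟨r, hr⟩ := exists_pResidual_lt hi
  refine ⟨r, w, ⟨i, hi⟩, fun j => (pResidual_eq_bot_iff _ _).1 (by_contra fun hj => ?_)⟩
  have hmin' : ¬ ∑ i, Nat.card (iteratedResidual (r :: w) (A i)) <
      ∑ i, Nat.card (iteratedResidual w (A i)) := hmin (r :: w) ⟨j, hj⟩
  refine hmin' (Finset.sum_lt_sum (fun i _ => ?_) ⟨i, Finset.mem_univ i, ?_⟩)
  · exact card_le_of_le (pResidual_le _ _)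
  · exact Set.Finite.card_lt_card (Set.toFinite _) hr

omit [Finite G] in
theorem iteratedResidual_closure_eq {p : ℕ} (hp : p.Prime) (hw : ∀ r ∈ w, (r : ℕ) ≠ p) {S : Set G}
    (hS : ∀ s ∈ S, orderOf s = p) : iteratedResidual w (closure S) = closure S := by
  induction w with
  | nil => rfl
  | cons r w ih =>
    rw [iteratedResidual, ih fun q hq => hw q (List.mem_cons_of_mem _ hq)]
    refine le_antisymm (pResidual_le _ _) ((closure_le _).2 fun s hs => ?_)
    refine mem_pResidual (subset_closure hs) ?_
    rw [hS s hs]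
    exact (Nat.coprime_primes hp r.2).2 (hw r List.mem_cons_self).symm

end Subgroup

/-! ### From seven conjugates to the theorem. -/

theorem exists_five_conj_iteratedResidual_ne_bot {G : Type u} [Group G] [Finite G] {z : G}
    {ι : Type*} {w : List Nat.Primes} {c₀ : ι → G} (hc₀ : ∀ i, IsConj z (c₀ i))
    (hs : Group.IsSolvable (closure (Set.range c₀)))
    (h : iteratedResidual w (closure (Set.range c₀)) ≠ ⊥) :
    ∃ c : Fin 5 → G, (∀ i, IsConj z (c i)) ∧ Set.range c ⊆ closure (Set.range c₀) ∧
      iteratedResidual w (closure (Set.range c)) ≠ ⊥ := by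
  set K := closure (Set.range c₀)
  have hconj : ∀ g : K, ∀ d ∈ {x : K | IsConj z (x : G)}, g * d * g⁻¹ ∈ {x : K | IsConj z (x : G)} :=
    fun g d hd => IsConj.trans hd (isConj_iff.2 ⟨(g : G), rfl⟩)
  have htop : closure {x : K | IsConj z (x : G)} = ⊤ := by
    refine top_le_iff.1 (closure_closure_coe_preimage.ge.trans (closure_mono ?_))
    rintro ⟨_, _⟩ ⟨i, rfl⟩
    exact hc₀ i
  have hbot : iteratedResidual w (⊤ : Subgroup K) ≠ ⊥ := by
    intro hbot
    have := map_iteratedResidual w K.subtype ⊤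
    rw [hbot, Subgroup.map_bot, ← MonoidHom.range_eq_map, range_subtype] at this
    exact h this.symm
  obtain ⟨c, hc, hne⟩ := exists_five_iteratedResidual_ne_bot w _ hconj htop hbot
  refine ⟨fun i => c i, hc, ?_, fun hbot => hne ?_⟩
  · rintro _ ⟨i, rfl⟩
    exact (c i).2
  · rw [← Subgroup.map_eq_bot_iff_of_injective _ K.subtype_injective, map_iteratedResidual,
      MonoidHom.map_closure, ← Set.range_comp]
    exact hbot

theorem exists_isPGroup_normalClosure {G : Type u} [Group G] [Finite G] {z : G} {p : ℕ}
    (hp : p.Prime) (hz : orderOf z = p)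
    (hC : ∀ c : Fin 7 → G, (∀ i, IsConj z (c i)) →
      Group.IsSolvable (closure (Set.range c))) :
    ∃ (r : Nat.Primes) (u : G), u ≠ 1 ∧ IsPGroup r (normalClosure {u}) := by
  have hz1 : z ≠ 1 := by
    rintro rfl
    exact hp.ne_one (by simpa using hz.symm)
  have horder : ∀ x, IsConj z x → orderOf x = p := by
    intro x hx
    obtain ⟨g, rfl⟩ := isConj_iff.1 hx
    rw [← hz]
    exact (MulAut.conj g).orderOf_eq z
  obtain ⟨r, w, ⟨⟨c₀, hc₀⟩, hne₀⟩, hr⟩ := exists_isPGroup_iteratedResidual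
    (fun c : {c : Fin 7 → G // ∀ i, IsConj z (c i)} => closure (Set.range c.1))
    (fun c => hC c.1 c.2) ⟨⟨fun _ => z, fun _ => IsConj.refl z⟩, fun h => hz1 <| by
      have : z ∈ closure (Set.range fun _ : Fin 7 => z) := subset_closure ⟨0, rfl⟩
      have h' : closure (Set.range fun _ : Fin 7 => z) = ⊥ := h
      rwa [h', mem_bot] at this⟩
  replace hr := fun c hc => hr ⟨c, hc⟩
  dsimp only at hr hne₀
  have : Fact (r : ℕ).Prime := ⟨r.2⟩
  by_cases hpw : ∀ q ∈ w, (q : ℕ) ≠ p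
  · refine ⟨r, z, hz1, isPGroup_normalClosure_of_forall_isPGroup_closure_pair z fun g => ?_⟩
    have hconj : ∀ i, IsConj z ((Fin.cons z fun _ : Fin 6 => g * z * g⁻¹ : Fin 7 → G) i) := by
      intro i
      refine Fin.cases (IsConj.refl z) (fun i => ?_) i
      exact isConj_iff.2 ⟨g, rfl⟩
    have h := hr _ hconj
    rw [iteratedResidual_closure_eq hp hpw (by rintro _ ⟨i, rfl⟩; exact horder _ (hconj i))] at h
    refine h.to_le (closure_mono ?_)
    rintro _ (rfl | rfl)
    · exact ⟨0, rfl⟩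
    · exact ⟨1, rfl⟩
  push Not at hpw
  obtain ⟨q, hqw, hqp⟩ := hpw
  obtain ⟨c, hc, hcK, hne⟩ := exists_five_conj_iteratedResidual_ne_bot hc₀ (hC _ hc₀) hne₀
  have hPr : IsPGroup r (iteratedResidual w (closure (Set.range c))) :=
    (hr _ hc₀).to_le (iteratedResidual_mono w ((closure_le _).2 hcK))
  -- Were the residual central, it would be trivial: directly if `r ∈ w`; otherwise `r ≠ p`, since
  -- `p` occurs in `w`, and a group generated by elements of order `p` is its own `r`-residual.
  have hnc : ∃ j, ∃ v ∈ iteratedResidual w (closure (Set.range c)), v * c j ≠ c j * v := by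
    by_contra! hcomm
    have hcent : ∀ x ∈ iteratedResidual w (closure (Set.range c)),
        ∀ h ∈ closure (Set.range c), h * x = x * h := by
      intro x hx h hh
      induction hh using closure_induction with
      | mem y hy =>
        obtain ⟨j, rfl⟩ := hy
        exact (hcomm j x hx).symm
      | one => simp
      | inv y _ ih => exact (show Commute y x from ih).inv_left
      | mul y y' _ _ ih ih' => exact (show Commute y x from ih).mul_left ih'
    by_cases hrw : r ∈ w
    · exact hne (iteratedResidual_eq_bot_of_mem hrw hPr hcent)
    · have hrp : ∀ q' ∈ [r], (q' : ℕ) ≠ p := by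
        simp only [List.mem_singleton, forall_eq]
        intro h
        exact hrw (Nat.Primes.coe_nat_injective (h.trans hqp.symm) ▸ hqw)
      have h1 : pResidual r (closure (Set.range c)) = closure (Set.range c) :=
        iteratedResidual_closure_eq (w := [r]) hp hrp
          (by rintro _ ⟨i, rfl⟩; exact horder _ (hc i))
      have h2 := iteratedResidual_inf_pResidual_eq_bot hrw hPr hcent
      rw [h1, inf_eq_left.2 (iteratedResidual_le _ _)] at h2
      exact hne h2
  obtain ⟨j, v, hv, hvc⟩ := hnc
  have hcj : c j ∈ closure (Set.range c) := subset_closure ⟨j, rfl⟩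
  have hu : v * c j * v⁻¹ * (c j)⁻¹ ∈ iteratedResidual w (closure (Set.range c)) := by
    have := mul_mem hv (conj_mem_iteratedResidual_of_mem w hcj (inv_mem hv))
    simpa [mul_assoc] using this
  refine ⟨r, v * c j * v⁻¹ * (c j)⁻¹, fun h => hvc (by simpa [mul_inv_eq_iff_eq_mul] using h),
    isPGroup_normalClosure_of_forall_isPGroup_closure_pair _ fun g => ?_⟩
  -- The two extra conjugates have quotient `g * u * g⁻¹`; the remaining five keep `u` in the
  -- residual.
  have hconj : ∀ i, IsConj z ((Fin.cons (g * v * c j * (g * v)⁻¹)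
      (Fin.cons (g * c j * g⁻¹) c : Fin 6 → G) : Fin 7 → G) i) := by
    intro i
    refine Fin.cases ((hc j).trans (isConj_iff.2 ⟨g * v, rfl⟩)) (fun i => ?_) i
    refine Fin.cases ((hc j).trans (isConj_iff.2 ⟨g, rfl⟩)) (fun i => hc i) i
  have h := hr _ hconj
  set e : Fin 7 → G := Fin.cons (g * v * c j * (g * v)⁻¹)
      (Fin.cons (g * c j * g⁻¹) c : Fin 6 → G) with he
  set u := v * c j * v⁻¹ * (c j)⁻¹
  have hue : u ∈ iteratedResidual w (closure (Set.range e)) := by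
    refine iteratedResidual_mono w (closure_mono ?_) hu
    rintro _ ⟨i, rfl⟩
    exact ⟨i.succ.succ, rfl⟩
  have hgu : g * u * g⁻¹ ∈ closure (Set.range e) := by
    have h0 : g * v * c j * (g * v)⁻¹ ∈ closure (Set.range e) := subset_closure ⟨0, rfl⟩
    have h1 : g * c j * g⁻¹ ∈ closure (Set.range e) := subset_closure ⟨1, rfl⟩
    have h2 : g * u * g⁻¹ = g * v * c j * (g * v)⁻¹ * (g * c j * g⁻¹)⁻¹ := by
      simp only [u]
      group
    exact h2 ▸ mul_mem h0 (inv_mem h1)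
  have hz : IsPGroup r (zpowers (g * u * g⁻¹)) := by
    obtain ⟨k, hk⟩ := h ⟨u, hue⟩
    have hk' : u ^ (r : ℕ) ^ k = 1 := congrArg Subtype.val hk
    refine IsPGroup.of_card_dvd_pow (n := k) ?_
    rw [Nat.card_zpowers]
    exact orderOf_dvd_of_pow_eq_one (by rw [conj_pow, hk']; simp)
  refine (hz.to_sup_of_normal_right' h (le_normalizer_iff.2 fun x hx y hy =>
    conj_mem_iteratedResidual_of_mem w ((zpowers_le.2 hgu) hx) hy)).to_le ?_
  refine (closure_le _).2 ?_
  rintro _ (rfl | rfl)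
  · exact mem_sup_right hue
  · exact mem_sup_left (mem_zpowers _)

theorem isSolvable_normalClosure {G : Type u} [Group G] [Finite G] (x : G)
    (hx : ∀ g : Fin 7 → G, Group.IsSolvable (closure (Set.range fun i => g i * x * (g i)⁻¹))) :
    Group.IsSolvable (normalClosure {x}) := by
  induction hn : Nat.card G using Nat.strong_induction_on generalizing G with | _ n ih
  subst hn
  by_cases hx1 : x = 1
  · have : normalClosure {x} = ⊥ := by rw [hx1, ← le_bot_iff]; exact normalClosure_le_normal (by simp)
    rw [this]
    infer_instance
  obtain ⟨p, hp, hpx⟩ := Nat.exists_prime_and_dvd (orderOf_eq_one_iff.not.2 hx1)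
  -- The power of `x` of order `p`: any seven of its conjugates lie in the group generated by the
  -- corresponding conjugates of `x`.
  obtain ⟨r, u, hu, hN⟩ := exists_isPGroup_normalClosure (z := x ^ (orderOf x / p)) hp
    (orderOf_pow_orderOf_div (orderOf_pos x).ne' hpx) fun c hc => by
      choose g hg using fun i => isConj_iff.1 (hc i)
      have := hx g
      refine Group.isSolvable_of_isSolvable_injective (inclusion_injective
        ((closure_le (closure (Set.range fun i => g i * x * (g i)⁻¹))).2 ?_))
      rintro _ ⟨i, rfl⟩
      rw [← hg i, ← conj_pow]
      have hm : g i * x * (g i)⁻¹ ∈ closure (Set.range fun i => g i * x * (g i)⁻¹) :=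
        Subgroup.subset_closure ⟨i, rfl⟩
      exact pow_mem hm _
  have : Fact (r : ℕ).Prime := ⟨r.2⟩
  set N := normalClosure {u}
  have hNs : Group.IsSolvable N := by
    have := hN.isNilpotent
    infer_instance
  have hcard : Nat.card (G ⧸ N) < Nat.card G := by
    rw [card_eq_card_quotient_mul_card_subgroup N]
    refine lt_mul_of_one_lt_right Nat.card_pos ((one_lt_card_iff_ne_bot N).2 fun h => hu ?_)
    rw [← mem_bot, ← h]
    exact subset_normalClosure rfl
  have hq : Group.IsSolvable (normalClosure {(QuotientGroup.mk' N) x}) := by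
    refine ih _ hcard _ (fun g' => ?_) rfl
    choose g hg using fun i => QuotientGroup.mk'_surjective N (g' i)
    have := hx g
    have hmap : closure (Set.range fun i => g' i * (QuotientGroup.mk' N) x * (g' i)⁻¹) =
        (closure (Set.range fun i => g i * x * (g i)⁻¹)).map (QuotientGroup.mk' N) := by
      rw [MonoidHom.map_closure, ← Set.range_comp]
      congr 2
      ext i
      simp only [Function.comp_apply, map_mul, map_inv, hg]
    rw [hmap]
    exact Group.isSolvable_of_surjective (MonoidHom.subgroupMap_surjective (QuotientGroup.mk' N) _)
  rw [← Set.image_singleton, ← map_normalClosure _ _ (QuotientGroup.mk'_surjective N)] at hq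
  have hNM : Group.IsSolvable (N.subgroupOf (normalClosure {x})) :=
    Group.isSolvable_of_isSolvable_injective
      (f := ((normalClosure {x}).subtype.subgroupComap N)) fun a b hab =>
        Subtype.ext (Subtype.ext (congrArg (fun t : N => (t : G)) hab))
  refine Group.isSolvable_of_ker_le_range (N.subgroupOf (normalClosure {x})).subtype
    ((QuotientGroup.mk' N).subgroupMap (normalClosure {x})) fun y hy => ?_
  rw [range_subtype, mem_subgroupOf, ← QuotientGroup.ker_mk' N, MonoidHom.mem_ker]
  exact congrArg Subtype.val hy

theorem theorem4 {G : Type*} [Group G] [Finite G] (C : ConjClasses G)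
    (hC : ∀ c : Fin 7 → G, (∀ i, c i ∈ C.carrier) →
      Group.IsSolvable (Subgroup.closure (Set.range c))) :
    Group.IsSolvable (Subgroup.closure C.carrier) := by
  obtain ⟨x, rfl⟩ := ConjClasses.exists_rep C
  have hmem : ∀ y, y ∈ (ConjClasses.mk x).carrier ↔ IsConj x y := fun y => by
    rw [ConjClasses.mem_carrier_iff_mk_eq, ConjClasses.mk_eq_mk_iff_isConj, isConj_comm]
  have := isSolvable_normalClosure x fun g => hC _ fun i => (hmem _).2 (isConj_iff.2 ⟨g i, rfl⟩)
  refine Group.isSolvable_of_isSolvable_injective (inclusion_injective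
    ((closure_le (normalClosure {x})).2 fun y hy => ?_))
  obtain ⟨g, rfl⟩ := isConj_iff.1 ((hmem y).1 hy)
  exact normalClosure_normal.conj_mem x (subset_normalClosure (Set.mem_singleton x)) g
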